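/- Consider $N\ge 1$ linear systems of state dimension $n\ge 1$ and output dimension $p$, given by real matrices $A_i, A_{ij}, G_i\in\mathbb{R}^{n\times n}$ ($j\ne i$) and $c_i\in\mathbb{R}^{n\times p}$, $i=1,\dots,N$. Assume that for each $i$ the pair $(A_i,c_i)$ is observable, $G_i$ is nonsingular, and the triplet $(A_i,c_i,G_iG_i^\top)$ is regular; here $(A,c,P)$ with $(A,c)$ observable and $P>0$ is called regular if for some $r>0$ the pair $(A,\Sigma c)$ is controllable, where $\Sigma$ is the positive definite solution of $A\Sigma+\Sigma A^\top-r\Sigma cc^\top\Sigma+P=0$. Let $r_{\min}>0$ and $\sigma_{\max}>0$. For $\epsilon\in\mathbb{R}$ let $A=A(\epsilon)$ be the $nN\times nN$ matrix with diagonal blocks $A_i$ and off-diagonal blocks $\epsilon A_{ij}$, let $G=\operatorname{diag}(G_1,\dots,G_N)$, and for $\gamma\in\mathbb{R}^N$ with all $\gamma_i>-r_{\min}$ let $c_\gamma=\operatorname{diag}(\sqrt{\gamma_1+r_{\min}}\,c_1,\dots,\sqrt{\gamma_N+r_{\min}}\,c_N)$, and let $\eta(\gamma)=\operatorname{tr}\Sigma(\gamma)$,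 where $\Sigma(\gamma)$ is the positive definite solution of $$A\Sigma+\Sigma A^\top-\Sigma c_\gamma c_\gamma^\top\Sigma+GG^\top=0 .$$ For $\sigma\ge0$ let $\operatorname{Sp}[\sigma]=\{v\in\mathbb{R}^N : v_i\ge 0,\ \sum_i v_i=\sigma\}$, and let $f(\sigma)=\arg\min_{\gamma\in\operatorname{Sp}[\sigma]}\eta(\gamma)$ be the optimal allocation map. Call $\mu\in\mathbb{R}$ a KKT multiplier at $\sigma$ if $\frac{\partial\eta}{\partial\gamma_i}(f(\sigma))=\mu$ whenever $f_i(\sigma)>0$ and $\frac{\partial\eta}{\partial\gamma_j}(f(\sigma))\ge\mu$ whenever $f_j(\sigma)=0$. Let $\mu_\sigma$ be the KKT multiplier at $\sigma$ (for $\sigma>0$ it is unique; for $\sigma=0$ take the largest one), and let $\mathcal J_\sigma=\{i : \frac{\partial\eta}{\partial\gamma_i}(f(\sigma))=\mu_\sigma\}$. Then there is $\epsilon_0>0$ (depending on the above data, including $r_{\min}$ and $\sigma_{\max}$) such that for every $\epsilon$ with $|\epsilon|\le\epsilon_0$ the following hold. 1. These objects are well defined: for every $\gamma\in\bigcup_{0\le\sigma\le\sigma_{\max}}\operatorname{Sp}[\sigma]$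 the Riccati equation has exactly one positive definite solution and $\eta$ is differentiable at $\gamma$; and for every $\sigma\in[0,\sigma_{\max}]$ the function $\eta$ has exactly one minimizer $f(\sigma)$ on $\operatorname{Sp}[\sigma]$, and $\mu_\sigma$ exists. 2. For every $\sigma\in[0,\sigma_{\max})$ the right-derivative $\partial_+f(\sigma)=\lim_{h\to0,\,h>0}\frac{f(\sigma+h)-f(\sigma)}{h}$ exists, the map $\partial_+f$ is right-continuous at $\sigma$, and $$\partial_+f_i(\sigma)>0\ \text{ if } i\in\mathcal J_\sigma,\qquad \partial_+f_i(\sigma)=0\ \text{ if } i\notin\mathcal J_\sigma .$$ -/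

import Mathlib

open Set Filter Topology

namespace OptAlloc

noncomputable section

/-! ### Linear systems: controllability, observability, algebraic Riccati equations -/

/-- The controllability matrix `[B, A B, …, A ^ (d - 1) B]` of a pair `(A, B)`, where `d` is
the state dimension. Its columns are indexed by pairs (power of `A`, column of `B`). -/
def controllabilityMatrix {m q : Type*} [Fintype m] [DecidableEq m]
    (A : Matrix m m ℝ) (B : Matrix m q ℝ) : Matrix m (Fin (Fintype.card m) × q) ℝ :=
  Matrix.of fun i kj => (A ^ (kj.1 : ℕ) * B) i kj.2

/-- The pair `(A, B)` (dynamics `ẋ = A x + B u`) is controllable: Kalman's rank condition. -/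
def Controllable {m q : Type*} [Fintype m] [DecidableEq m] [Fintype q]
    (A : Matrix m m ℝ) (B : Matrix m q ℝ) : Prop :=
  (controllabilityMatrix A B).rank = Fintype.card m

/-- The pair `(A, c)` (dynamics `ẋ = A x`, output `y = cᵀ x`) is observable: the observability
matrix, i.e. the transpose of `[c, Aᵀ c, …, (Aᵀ) ^ (d - 1) c]`, has full rank. -/
def Observable {m q : Type*} [Fintype m] [DecidableEq m] [Fintype q]
    (A : Matrix m m ℝ) (c : Matrix m q ℝ) : Prop :=
  Controllable A.transpose c

/-- `X` is a positive definite solution of the algebraic Riccati equation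
`A X + X Aᵀ - X c cᵀ X + P = 0`. -/
def IsPosDefAREsol {m q : Type*} [Fintype m] [Fintype q]
    (A : Matrix m m ℝ) (c : Matrix m q ℝ) (P X : Matrix m m ℝ) : Prop :=
  X.PosDef ∧ A * X + X * A.transpose - X * (c * c.transpose) * X + P = 0

/-- `(A, c, P)` is a regular triplet: `(A, c)` is observable, `P` is positive definite, and for
some `r > 0` the pair `(A, X c)` is controllable, where `X` is the positive definite solution of
`A X + X Aᵀ - r X c cᵀ X + P = 0`. -/
def RegularTriplet {m q : Type*} [Fintype m] [DecidableEq m] [Fintype q]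
    (A : Matrix m m ℝ) (c : Matrix m q ℝ) (P : Matrix m m ℝ) : Prop :=
  Observable A c ∧ P.PosDef ∧
    ∃ r : ℝ, 0 < r ∧ ∃ X : Matrix m m ℝ,
      IsPosDefAREsol A (Real.sqrt r • c) P X ∧ Controllable A (X * c)

/-! ### Simplices and right-derivatives -/

/-- The simplex `Sp[σ]` of height `σ` in `ℝ^N`. -/
def Sp (N : ℕ) (σ : ℝ) : Set (Fin N → ℝ) :=
  {v | (∀ i, 0 ≤ v i) ∧ ∑ i, v i = σ}

/-- `Ch[σ_max]`, the union of the simplices `Sp[σ]` for `0 ≤ σ ≤ σ_max`. -/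
def Ch (N : ℕ) (σmax : ℝ) : Set (Fin N → ℝ) :=
  ⋃ σ ∈ Set.Icc 0 σmax, Sp N σ

/-- The right-derivative `∂₊ f (σ)` (meaningful where the one-sided limit exists). -/
def rightDeriv {N : ℕ} (f : ℝ → Fin N → ℝ) (σ : ℝ) : Fin N → ℝ :=
  derivWithin f (Set.Ioi σ) σ

/-! ### Networks of weakly coupled systems -/

/-- The data of a network of `N` linear systems with state dimension `n` and output dimension `p`:
`dx_i = (A_i x_i + ε ∑_{j ≠ i} A_{ij} x_j) dt + G_i dw_i`, `dz_i = √r_i c_iᵀ x_i dt + dν_i`. -/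
structure Network (N n p : ℕ) where
  /-- internal dynamics `A_i` -/
  A : Fin N → Matrix (Fin n) (Fin n) ℝ
  /-- coupling matrices `A_{ij}`; only the values at `i ≠ j` are used -/
  Acoup : Fin N → Fin N → Matrix (Fin n) (Fin n) ℝ
  /-- noise matrices `G_i` -/
  G : Fin N → Matrix (Fin n) (Fin n) ℝ
  /-- observation matrices `c_i` -/
  c : Fin N → Matrix (Fin n) (Fin p) ℝ

namespace Network

variable {N n p : ℕ} (S : Network N n p)

/-- The standing assumption on the subsystems. -/
def SubsystemAssumption : Prop :=
  ∀ i, Observable (S.A i) (S.c i) ∧ IsUnit (S.G i) ∧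
    RegularTriplet (S.A i) (S.c i) (S.G i * (S.G i).transpose)

/-- The `nN × nN` matrix with diagonal blocks `A_i` and off-diagonal blocks `ε A_{ij}`.
An index `(k, i)` stands for the `k`-th coordinate of the `i`-th subsystem. -/
def bigA (ε : ℝ) : Matrix (Fin n × Fin N) (Fin n × Fin N) ℝ :=
  Matrix.of fun a b =>
    if a.2 = b.2 then S.A a.2 a.1 b.1 else ε * S.Acoup a.2 b.2 a.1 b.1

/-- `G = diag(G_1, …, G_N)`. -/
def bigG : Matrix (Fin n × Fin N) (Fin n × Fin N) ℝ :=
  Matrix.blockDiagonal S.G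

/-- `c_γ = diag(√(γ_1 + r_min) c_1, …, √(γ_N + r_min) c_N)`. -/
def cγ (rmin : ℝ) (γ : Fin N → ℝ) : Matrix (Fin n × Fin N) (Fin p × Fin N) ℝ :=
  Matrix.blockDiagonal fun i => Real.sqrt (γ i + rmin) • S.c i

/-- `X` is a positive definite solution of the network Riccati equation
`A X + X Aᵀ - X c_γ c_γᵀ X + G Gᵀ = 0`. -/
def IsCov (rmin ε : ℝ) (γ : Fin N → ℝ) (X : Matrix (Fin n × Fin N) (Fin n × Fin N) ℝ) : Prop :=
  IsPosDefAREsol (S.bigA ε) (S.cγ rmin γ) (S.bigG * S.bigG.transpose) X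

/-- `Σ(γ)`, the positive definite solution of the network Riccati equation. -/
def cov (rmin ε : ℝ) (γ : Fin N → ℝ) : Matrix (Fin n × Fin N) (Fin n × Fin N) ℝ :=
  Classical.epsilon (S.IsCov rmin ε γ)

/-- The estimation error `η(γ) = tr Σ(γ)`. -/
def η (rmin ε : ℝ) (γ : Fin N → ℝ) : ℝ :=
  (S.cov rmin ε γ).trace

/-- The partial derivative `∂η / ∂γ_i` at `γ`. -/
def dη (rmin ε : ℝ) (γ : Fin N → ℝ) (i : Fin N) : ℝ :=
  lineDeriv ℝ (S.η rmin ε) γ (Pi.single i 1)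

/-- The optimal allocation map `f(σ) = argmin_{γ ∈ Sp[σ]} η(γ)`. -/
def f (rmin ε : ℝ) (σ : ℝ) : Fin N → ℝ :=
  Classical.epsilon fun γ => γ ∈ Sp N σ ∧ IsMinOn (S.η rmin ε) (Sp N σ) γ

/-- `I_σ`, the set of indices of the positive entries of `f(σ)`. -/
def I (rmin ε : ℝ) (σ : ℝ) : Set (Fin N) :=
  {i | 0 < S.f rmin ε σ i}

/-- `μ` is a KKT multiplier at `f(σ)`: the partial derivatives of `η` at `f(σ)` are equal to `μ`
for the indices in `I_σ`, and at least `μ` for the others. -/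
def IsKKTMultiplier (rmin ε : ℝ) (σ μ : ℝ) : Prop :=
  (∀ i ∈ S.I rmin ε σ, S.dη rmin ε (S.f rmin ε σ) i = μ) ∧
    ∀ j ∉ S.I rmin ε σ, μ ≤ S.dη rmin ε (S.f rmin ε σ) j

/-- The KKT multiplier `μ_σ`. For `σ > 0` the conditions have at most one solution, because `I_σ`
is nonempty; for `σ = 0`, where `f(σ) = 0`, `μ_σ` is the largest solution. -/
def kktMultiplier (rmin ε : ℝ) (σ : ℝ) : ℝ :=
  sSup {μ | S.IsKKTMultiplier rmin ε σ μ}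

/-- `J_σ`, the set of indices `i` with `∂η / ∂γ_i = μ_σ` at `f(σ)`. -/
def J (rmin ε : ℝ) (σ : ℝ) : Set (Fin N) :=
  {i | S.dη rmin ε (S.f rmin ε σ) i = S.kktMultiplier rmin ε σ}

end Network

end

end OptAlloc

open scoped Matrix

namespace OptAlloc

noncomputable section

/-! ### Positive definite matrices and Lyapunov equations -/

section Lyapunov

/-! At `ε = 0` the network decouples and `η γ` is a sum of functions `t i (γ i + rmin)`, where `t i
r` is the trace of the Riccati solution of subsystem `i` at gain `r`. Each `t i` has positive second
derivative for `r > 0`, so the Hessian of `η` is diagonal with positive entries. Solvability,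
smoothness and `DiagDominant` of the Hessian then persist near every `(0, γ)`, and compactness of
`Ch N σmax` makes one `ε₀` serve all `γ`.

On the Riccati side, a positive definite solution `X` is itself a strict Lyapunov certificate for
its closed loop `A - X * C` (`posDef_closedLoop`). Through `sylvester_eq_zero` this gives uniqueness
and an invertible linearisation, hence smooth dependence on parameters. Through
`lyapunov_posSemidef` it gives monotonicity in the data and convexity in the gain. Regularity
supplies a solution at one gain, and a continuity argument carries it to all positive gains.

On the optimization side, diagonal dominance makes `η` strictly convex on `Ch`, so a KKT point of a
simplex is its unique minimizer. Near `σ₀`, the equations "equal partial derivatives on `J`, zero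
allocation off `J`, total `σ`" define a C¹ curve `c` with multiplier `μ`. Differentiating, `H c' =
μ'` on `J`, `c' = 0` off `J` and `∑ c' = 1`; pairing with `c'` gives `μ' = c'ᵀ H c' > 0`, and
dominance then forces `c' > 0` on `J`. Hence to the right of `σ₀` the curve stays in the simplex and
satisfies KKT, so it coincides with `f`. -/

theorem _root_.Matrix.PosDef.transpose_eq {m : Type*} {X : Matrix m m ℝ} (hX : X.PosDef) : Xᵀ = X :=
  (Matrix.conjTranspose_eq_transpose_of_trivial X).symm.trans hX.isHermitian

theorem _root_.Matrix.PosSemidef.transpose_eq {m : Type*} {X : Matrix m m ℝ}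
    (hX : X.PosSemidef) : Xᵀ = X :=
  (Matrix.conjTranspose_eq_transpose_of_trivial X).symm.trans hX.isHermitian

variable {m : Type*} [Fintype m] [DecidableEq m]

theorem _root_.Matrix.PosSemidef.exists_eq_transpose_mul_self {X : Matrix m m ℝ}
    (hX : X.PosSemidef) : ∃ L : Matrix m m ℝ, X = Lᵀ * L := by
  open scoped MatrixOrder Matrix.Norms.L2Operator in
  obtain ⟨L, hL⟩ := CStarAlgebra.nonneg_iff_eq_star_mul_self.1 hX.nonneg
  exact ⟨L, by simpa [Matrix.star_eq_conjTranspose] using hL⟩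

theorem _root_.Matrix.PosDef.exists_eq_transpose_mul_self {X : Matrix m m ℝ} (hX : X.PosDef) :
    ∃ L : Matrix m m ℝ, IsUnit L ∧ X = Lᵀ * L := by
  obtain ⟨L, hL⟩ := hX.posSemidef.exists_eq_transpose_mul_self
  refine ⟨L, ?_, hL⟩
  have h := hX.isUnit
  rw [Matrix.isUnit_iff_isUnit_det, hL, Matrix.det_mul] at h
  exact (Matrix.isUnit_iff_isUnit_det _).2 (isUnit_of_mul_isUnit_right h)

theorem trace_mul_conj_nonneg {Q X : Matrix m m ℝ} (hQ : Q.PosSemidef) (hX : X.PosSemidef)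
    (B : Matrix m m ℝ) : 0 ≤ (Q * (B * X * Bᵀ)).trace := by
  obtain ⟨L, rfl⟩ := hX.exists_eq_transpose_mul_self
  have h := (hQ.conjTranspose_mul_mul_same (B * Lᵀ)).trace_nonneg
  rw [Matrix.trace_mul_comm, ← mul_assoc, Matrix.trace_mul_comm] at h
  simpa [mul_assoc] using h

/-- Writing `Q = Kᵀ * K` and `X = Lᵀ * L` with invertible factors, the trace is the squared
Frobenius norm of `K * B * Lᵀ`. -/
theorem eq_zero_of_trace_mul_conj {Q X : Matrix m m ℝ} (hQ : Q.PosDef) (hX : X.PosDef)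
    {B : Matrix m m ℝ} (h : (Q * (B * X * Bᵀ)).trace = 0) : B = 0 := by
  obtain ⟨L, hLu, rfl⟩ := hX.exists_eq_transpose_mul_self
  obtain ⟨K, hKu, rfl⟩ := hQ.exists_eq_transpose_mul_self
  have h' : ((K * B * Lᵀ)ᴴ * (K * B * Lᵀ)).trace = 0 := by
    rw [← h, ← Matrix.trace_mul_comm (B * (Lᵀ * L) * Bᵀ)]
    rw [show B * (Lᵀ * L) * Bᵀ * (Kᵀ * K) = (B * Lᵀ) * (L * Bᵀ * Kᵀ * K) by
      simp only [mul_assoc], Matrix.trace_mul_comm (B * Lᵀ)]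
    simp [mul_assoc]
  rw [Matrix.trace_conjTranspose_mul_self_eq_zero_iff] at h'
  have hLt : IsUnit Lᵀ := by
    rw [Matrix.isUnit_iff_isUnit_det] at hLu ⊢; rwa [Matrix.det_transpose]
  rw [hLt.mul_left_eq_zero, hKu.mul_right_eq_zero] at h'
  exact h'

theorem trace_conj_pos {Y D : Matrix m m ℝ} (hY : Y.PosDef) (hD : Dᵀ = D) (hne : D ≠ 0) :
    0 < (D * Y * D).trace := by
  have h0 := trace_mul_conj_nonneg (Matrix.PosSemidef.one (n := m) (R := ℝ)) hY.posSemidef D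
  rw [one_mul, hD] at h0
  refine lt_of_le_of_ne h0 fun h => hne ?_
  refine eq_zero_of_trace_mul_conj (Matrix.PosDef.one (n := m) (R := ℝ)) hY ?_
  rw [one_mul, hD, ← h]

/-- A Sylvester equation `F₁ D + D F₂ᵀ = 0` whose coefficients both admit a strict Lyapunov
certificate has only the trivial solution. -/
theorem sylvester_eq_zero {F₁ F₂ X₁ X₂ D : Matrix m m ℝ} (h₁ : X₁.PosDef) (h₂ : X₂.PosDef)
    (hQ₁ : (-(F₁ * X₁ + X₁ * F₁ᵀ)).PosDef) (hQ₂ : (-(F₂ * X₂ + X₂ * F₂ᵀ)).PosDef)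
    (h : F₁ * D + D * F₂ᵀ = 0) : D = 0 := by
  -- In this parametrization, multiplying the equation by `Bᵀ` and taking the trace gives zero as a
  -- sum of two terms. By symmetry each is minus half the trace of a certificate against a conjugate
  -- of `X₂` or `X₁`, so both vanish, and the first forces `B = 0`.
  obtain ⟨B, rfl⟩ : ∃ B, D = X₁ * B * X₂ := by
    refine ⟨X₁⁻¹ * D * X₂⁻¹, ?_⟩
    have e1 := Matrix.mul_nonsing_inv X₁ ((Matrix.isUnit_iff_isUnit_det _).1 h₁.isUnit)
    have e2 := Matrix.nonsing_inv_mul X₂ ((Matrix.isUnit_iff_isUnit_det _).1 h₂.isUnit)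
    rw [← mul_assoc, ← mul_assoc, e1, one_mul, mul_assoc, e2, mul_one]
  have s1 : (F₁ * X₁ * (B * X₂ * Bᵀ)).trace = (X₁ * F₁ᵀ * (B * X₂ * Bᵀ)).trace := by
    rw [← Matrix.trace_transpose]
    simp only [Matrix.transpose_mul, Matrix.transpose_transpose, h₁.transpose_eq, h₂.transpose_eq]
    rw [Matrix.trace_mul_comm]
    simp only [mul_assoc]
  have s2 : (F₂ * X₂ * (Bᵀ * X₁ * B)).trace = (X₂ * F₂ᵀ * (Bᵀ * X₁ * B)).trace := by
    rw [← Matrix.trace_transpose]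
    simp only [Matrix.transpose_mul, Matrix.transpose_transpose, h₁.transpose_eq, h₂.transpose_eq]
    rw [Matrix.trace_mul_comm]
    simp only [mul_assoc]
  have s3 : (F₁ * X₁ * (B * X₂ * Bᵀ)).trace + (X₂ * F₂ᵀ * (Bᵀ * X₁ * B)).trace = 0 := by
    have h' := congrArg (fun M => (M * Bᵀ).trace) h
    simp only [add_mul, Matrix.trace_add, zero_mul, Matrix.trace_zero] at h'
    rw [← h', Matrix.trace_mul_comm (X₂ * F₂ᵀ), Matrix.trace_mul_comm (X₁ * B * X₂ * F₂ᵀ)]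
    simp only [mul_assoc]
  have n1 := trace_mul_conj_nonneg hQ₁.posSemidef h₂.posSemidef B
  have n2 := trace_mul_conj_nonneg hQ₂.posSemidef h₁.posSemidef Bᵀ
  have z1 : (-(F₁ * X₁ + X₁ * F₁ᵀ) * (B * X₂ * Bᵀ)).trace = 0 := by
    refine le_antisymm ?_ n1
    simp only [Matrix.neg_mul, add_mul, Matrix.trace_neg, Matrix.trace_add,
      Matrix.transpose_transpose] at n1 n2 ⊢
    linarith
  rw [eq_zero_of_trace_mul_conj hQ₁ h₂ z1]
  simp

/-- Positivity of the solution of a Lyapunov equation whose coefficient admits a strict Lyapunov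
certificate. -/
theorem lyapunov_posSemidef {F X D : Matrix m m ℝ} (hX : X.PosDef)
    (hQ : (-(F * X + X * Fᵀ)).PosDef) (hD : Dᵀ = D) (hR : (-(F * D + D * Fᵀ)).PosSemidef) :
    D.PosSemidef := by
  -- Diagonalize `D` relative to `X`: an eigenvector of `E` gives `v` with `D v = lam • X v`. The
  -- Lyapunov form of `D` at `v` is then `lam` times that of `X`, and `lam < 0` would give it the
  -- wrong sign.
  obtain ⟨L, hLu, rfl⟩ := hX.exists_eq_transpose_mul_self
  have hdet := (Matrix.isUnit_iff_isUnit_det _).1 hLu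
  have e1 : L⁻¹ * L = 1 := Matrix.nonsing_inv_mul L hdet
  have e2 : L * L⁻¹ = 1 := Matrix.mul_nonsing_inv L hdet
  have e3 : Lᵀ * (L⁻¹)ᵀ = 1 := by rw [← Matrix.transpose_mul, e1, Matrix.transpose_one]
  set E : Matrix m m ℝ := (L⁻¹)ᵀ * D * L⁻¹ with hE
  have hEh : E.IsHermitian := by
    rw [Matrix.IsHermitian, Matrix.conjTranspose_eq_transpose_of_trivial, hE]
    simp only [Matrix.transpose_mul, Matrix.transpose_transpose, hD, mul_assoc]
  have hDE : D = Lᵀ * E * L := by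
    rw [hE, show Lᵀ * ((L⁻¹)ᵀ * D * L⁻¹) * L = (Lᵀ * (L⁻¹)ᵀ) * D * (L⁻¹ * L) by
      simp only [mul_assoc], e1, e3, one_mul, mul_one]
  suffices E.PosSemidef by
    rw [hDE]; simpa using this.conjTranspose_mul_mul_same L
  rw [hEh.posSemidef_iff_eigenvalues_nonneg]
  intro i
  by_contra! hneg
  simp only [Pi.zero_apply] at hneg
  set lam := hEh.eigenvalues i
  set u : m → ℝ := (hEh.eigenvectorBasis i).ofLp with hu
  have hEu : E *ᵥ u = lam • u := hEh.mulVec_eigenvectorBasis i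
  have hu0 : u ≠ 0 := by
    intro h
    have := hEh.eigenvectorBasis.orthonormal.ne_zero i
    exact this (by ext j; exact congrFun h j)
  set v : m → ℝ := L⁻¹ *ᵥ u with hv
  have hLv : L *ᵥ v = u := by rw [hv, Matrix.mulVec_mulVec, e2, Matrix.one_mulVec]
  have hv0 : v ≠ 0 := by rintro h; rw [h, Matrix.mulVec_zero] at hLv; exact hu0 hLv.symm
  have hDv : D *ᵥ v = lam • ((Lᵀ * L) *ᵥ v) := by
    rw [hDE, ← Matrix.mulVec_mulVec, ← Matrix.mulVec_mulVec, hLv, hEu, Matrix.mulVec_smul,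
      ← Matrix.mulVec_mulVec, hLv]
  have key : ∀ M : Matrix m m ℝ, Mᵀ = M →
      v ⬝ᵥ ((F * M + M * Fᵀ) *ᵥ v) = 2 * ((Fᵀ *ᵥ v) ⬝ᵥ (M *ᵥ v)) := by
    intro M hM
    rw [Matrix.add_mulVec, dotProduct_add, ← Matrix.mulVec_mulVec, ← Matrix.mulVec_mulVec,
      Matrix.dotProduct_mulVec, Matrix.dotProduct_mulVec v M, ← Matrix.mulVec_transpose,
      ← Matrix.mulVec_transpose, hM, dotProduct_comm (M *ᵥ v), two_mul]
  have p1 := hQ.dotProduct_mulVec_pos hv0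
  have p2 := hR.dotProduct_mulVec_nonneg v
  simp only [star_trivial, Matrix.neg_mulVec, dotProduct_neg] at p1 p2
  rw [key _ hD, hDv, dotProduct_smul, smul_eq_mul] at p2
  rw [key _ (by simp)] at p1
  nlinarith

end Lyapunov

/-! ### Algebraic Riccati equations: uniqueness and comparison -/

section Riccati

variable {m : Type*} [Fintype m] [DecidableEq m]

/-- The Riccati operator `X ↦ A X + X Aᵀ - X C X + P`. -/
def riccati (A C P X : Matrix m m ℝ) : Matrix m m ℝ :=
  A * X + X * Aᵀ - X * C * X + P

/-- The Riccati equation rewrites the Lyapunov expression of `A - X * C` at `X` as `-(P + X * C *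
X)`. No separate stability theory is needed afterwards. -/
theorem posDef_closedLoop {A C P X : Matrix m m ℝ} (hX : X.PosDef) (hC : C.PosSemidef)
    (hP : P.PosDef) (h : riccati A C P X = 0) :
    (-((A - X * C) * X + X * (A - X * C)ᵀ)).PosDef := by
  have e : -((A - X * C) * X + X * (A - X * C)ᵀ) = P + X * C * X := by
    rw [riccati] at h
    rw [Matrix.transpose_sub, Matrix.transpose_mul, hX.transpose_eq, hC.transpose_eq]
    have h' : P = -(A * X + X * Aᵀ - X * C * X) := (neg_eq_of_add_eq_zero_right h).symm
    rw [h']; noncomm_ring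
  rw [e]
  refine hP.add_posSemidef ?_
  have := hC.conjTranspose_mul_mul_same X
  rwa [Matrix.conjTranspose_eq_transpose_of_trivial, hX.transpose_eq] at this

/-- The difference of the two equations is exactly the Sylvester equation for `X₁ - X₂` with the two
closed loops as coefficients; the mixed terms `X₁ * C * X₂` cancel. -/
theorem riccati_unique {A C P X₁ X₂ : Matrix m m ℝ} (hC : C.PosSemidef) (hP : P.PosDef)
    (h₁ : X₁.PosDef) (h₂ : X₂.PosDef) (e₁ : riccati A C P X₁ = 0) (e₂ : riccati A C P X₂ = 0) :
    X₁ = X₂ := by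
  rw [← sub_eq_zero]
  refine sylvester_eq_zero h₁ h₂ (posDef_closedLoop h₁ hC hP e₁) (posDef_closedLoop h₂ hC hP e₂) ?_
  rw [Matrix.transpose_sub, Matrix.transpose_mul, h₂.transpose_eq, hC.transpose_eq]
  rw [← sub_self (0 : Matrix m m ℝ)]
  nth_rewrite 1 [← e₁]
  rw [← e₂, riccati, riccati]
  noncomm_ring

/-- Monotonicity of the solution of the Riccati equation in the data. -/
theorem riccati_comparison {A C₁ C₂ P₁ P₂ X₁ X₂ : Matrix m m ℝ} (hC : C₁.PosSemidef)
    (hP : P₁.PosDef) (h₁ : X₁.PosDef) (h₂ : X₂.PosDef) (e₁ : riccati A C₁ P₁ X₁ = 0)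
    (e₂ : riccati A C₂ P₂ X₂ = 0) (hCC : (C₂ - C₁).PosSemidef) (hPP : (P₁ - P₂).PosSemidef) :
    (X₁ - X₂).PosSemidef := by
  have hD : (X₁ - X₂)ᵀ = X₁ - X₂ := by
    rw [Matrix.transpose_sub, h₁.transpose_eq, h₂.transpose_eq]
  refine lyapunov_posSemidef h₁ (posDef_closedLoop h₁ hC hP e₁) hD ?_
  -- Completing the square around `X₁` leaves only positive semidefinite terms.
  have e : -((A - X₁ * C₁) * (X₁ - X₂) + (X₁ - X₂) * (A - X₁ * C₁)ᵀ) =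
      (X₁ - X₂) * C₁ * (X₁ - X₂) + X₂ * (C₂ - C₁) * X₂ + (P₁ - P₂) := by
    rw [Matrix.transpose_sub, Matrix.transpose_mul, h₁.transpose_eq, hC.transpose_eq]
    have f₁ : P₁ = -(A * X₁ + X₁ * Aᵀ - X₁ * C₁ * X₁) := (neg_eq_of_add_eq_zero_right e₁).symm
    have f₂ : P₂ = -(A * X₂ + X₂ * Aᵀ - X₂ * C₂ * X₂) := (neg_eq_of_add_eq_zero_right e₂).symm
    rw [f₁, f₂]; noncomm_ring
  rw [e]
  refine (Matrix.PosSemidef.add ?_ ?_).add hPP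
  · have := hC.conjTranspose_mul_mul_same (X₁ - X₂)
    rwa [Matrix.conjTranspose_eq_transpose_of_trivial, hD] at this
  · have := hCC.conjTranspose_mul_mul_same X₂
    rwa [Matrix.conjTranspose_eq_transpose_of_trivial, h₂.transpose_eq] at this

end Riccati

/-! ### Smooth dependence of Riccati solutions on parameters -/

/-- In finite dimension an injective partial derivative is invertible, so each application reduces
to a kernel computation. It serves both for the Riccati equation and for the active-set equations.
-/
theorem exists_implicit_function {E₁ E₂ : Type*} [NormedAddCommGroup E₁] [NormedSpace ℝ E₁]
    [CompleteSpace E₁] [NormedAddCommGroup E₂] [NormedSpace ℝ E₂] [FiniteDimensional ℝ E₂]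
    {n : WithTop ℕ∞} (hn : n ≠ 0) {f : E₁ × E₂ → E₂} {u : E₁ × E₂} (hf : ContDiffAt ℝ n f u)
    (hinj : ∀ y, fderiv ℝ f u (0, y) = 0 → y = 0) :
    ∃ ψ : E₁ → E₂, ψ u.1 = u.2 ∧ ContDiffAt ℝ n ψ u.1 ∧
      ∀ᶠ v in 𝓝 u, (f v = f u ↔ ψ v.1 = v.2) := by
  have := FiniteDimensional.complete ℝ E₂
  have hinv : (fderiv ℝ f u ∘L .inr ℝ E₁ E₂).IsInvertible := by
    set g : E₂ →L[ℝ] E₂ := fderiv ℝ f u ∘L .inr ℝ E₁ E₂ with hg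
    have hgi : Function.Injective (g : E₂ →ₗ[ℝ] E₂) := by
      rw [← LinearMap.ker_eq_bot, LinearMap.ker_eq_bot']
      exact fun y hy => hinj y hy
    exact ⟨(LinearEquiv.ofInjectiveEndo (g : E₂ →ₗ[ℝ] E₂) hgi).toContinuousLinearEquiv,
      by ext y; rfl⟩
  exact ⟨hf.implicitFunction hn hinv, hf.implicitFunction_apply_self hn hinv,
    hf.contDiffAt_implicitFunction hn hinv, hf.eventually_apply_eq_iff_implicitFunction hn hinv⟩

section Smooth

open scoped Matrix.Norms.Operator

theorem eventually_posDef {m : Type*} [Fintype m] {X₀ : Matrix m m ℝ} (h : X₀.PosDef) :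
    ∀ᶠ X in 𝓝 X₀, X.IsHermitian → X.PosDef := by
  have hK : IsCompact (Metric.sphere (0 : m → ℝ) 1) := isCompact_sphere _ _
  have hcont : Continuous fun z : Matrix m m ℝ × (m → ℝ) => z.2 ⬝ᵥ (z.1 *ᵥ z.2) :=
    continuous_snd.dotProduct (continuous_fst.matrix_mulVec continuous_snd)
  have hev : ∀ᶠ X in 𝓝 X₀, ∀ x ∈ Metric.sphere (0 : m → ℝ) 1, 0 < x ⬝ᵥ (X *ᵥ x) := by
    refine hK.eventually_forall_of_forall_eventually fun x hx => ?_
    refine hcont.continuousAt.eventually (lt_mem_nhds ?_)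
    have hx0 : x ≠ 0 := by rintro rfl; simp at hx
    simpa using h.dotProduct_mulVec_pos hx0
  filter_upwards [hev] with X hX hXh
  refine Matrix.PosDef.of_dotProduct_mulVec_pos hXh fun x hx => ?_
  have hn : 0 < ‖x‖ := norm_pos_iff.2 hx
  have h1 := hX (‖x‖⁻¹ • x) (by simp [norm_smul, hn.ne'])
  rw [Matrix.mulVec_smul, dotProduct_smul, smul_dotProduct, smul_eq_mul, smul_eq_mul] at h1
  have h2 : 0 < ‖x‖⁻¹ := inv_pos.2 hn
  exact pos_of_mul_pos_right (pos_of_mul_pos_right h1 h2.le) h2.le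

theorem contDiff_transpose {m : Type*} [Fintype m] {n : WithTop ℕ∞} :
    ContDiff ℝ n (fun X : Matrix m m ℝ => Xᵀ) :=
  (LinearMap.toContinuousLinearMap
    (Matrix.transposeLinearEquiv m m ℝ ℝ).toLinearMap).contDiff

variable {m : Type*} [Fintype m] [DecidableEq m]

variable {E : Type*} [NormedAddCommGroup E] [NormedSpace ℝ E]

/-- The positive definite solution of a Riccati equation depends smoothly on parameters. -/
theorem exists_smooth_riccati_solution [CompleteSpace E] {n : WithTop ℕ∞} (hn : n ≠ 0)
    {A C : E → Matrix m m ℝ} {P X₀ : Matrix m m ℝ} {p₀ : E}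
    (hA : ContDiffAt ℝ n A p₀) (hC : ContDiffAt ℝ n C p₀) (hCs : ∀ p, (C p)ᵀ = C p)
    (hC₀ : (C p₀).PosSemidef) (hP : P.PosDef) (hX₀ : X₀.PosDef)
    (h₀ : riccati (A p₀) (C p₀) P X₀ = 0) :
    ∃ ψ : E → Matrix m m ℝ, ψ p₀ = X₀ ∧ ContDiffAt ℝ n ψ p₀ ∧
      ∀ᶠ p in 𝓝 p₀, (ψ p).PosDef ∧ riccati (A p) (C p) P (ψ p) = 0 := by
  set f : E × Matrix m m ℝ → Matrix m m ℝ := fun z => riccati (A z.1) (C z.1) P z.2 with hfdef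
  have hf : ContDiffAt ℝ n f (p₀, X₀) := by
    have hA' : ContDiffAt ℝ n (fun z : E × Matrix m m ℝ => A z.1) (p₀, X₀) :=
      ContDiffAt.comp (p₀, X₀) (g := A) hA contDiffAt_fst
    have hC' : ContDiffAt ℝ n (fun z : E × Matrix m m ℝ => C z.1) (p₀, X₀) :=
      ContDiffAt.comp (p₀, X₀) (g := C) hC contDiffAt_fst
    have hX' : ContDiffAt ℝ n (fun z : E × Matrix m m ℝ => z.2) (p₀, X₀) := contDiffAt_snd
    have hAt : ContDiffAt ℝ n (fun z : E × Matrix m m ℝ => (A z.1)ᵀ) (p₀, X₀) :=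
      contDiff_transpose.contDiffAt.comp _ hA'
    exact (((hA'.mul hX').add (hX'.mul hAt)).sub ((hX'.mul hC').mul hX')).add contDiffAt_const
  have hinj : ∀ D, fderiv ℝ f (p₀, X₀) (0, D) = 0 → D = 0 := by
    intro D hD
    have hline : HasDerivAt (fun t : ℝ => ((p₀, X₀ + t • D) : E × Matrix m m ℝ)) (0, D) 0 := by
      refine (hasDerivAt_const _ _).prodMk ?_
      have h := ((hasDerivAt_id (0 : ℝ)).smul_const D).const_add X₀
      rw [one_smul] at h
      exact h
    have hX : HasDerivAt (fun t : ℝ => X₀ + t • D) D 0 := by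
      have h := ((hasDerivAt_id (0 : ℝ)).smul_const D).const_add X₀
      rw [one_smul] at h
      exact h
    have hfd : HasFDerivAt f (fderiv ℝ f (p₀, X₀)) (p₀, X₀ + (0 : ℝ) • D) := by
      rw [zero_smul, add_zero]; exact (hf.differentiableAt hn).hasFDerivAt
    have h1 : HasDerivAt (fun t : ℝ => f (p₀, X₀ + t • D)) 0 0 := by
      rw [← hD]; exact hfd.comp_hasDerivAt (0 : ℝ) hline
    have h2 := ((((hasDerivAt_const (0 : ℝ) (A p₀)).mul hX).add
      (hX.mul (hasDerivAt_const (0 : ℝ) (A p₀)ᵀ))).sub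
      ((hX.mul (hasDerivAt_const (0 : ℝ) (C p₀))).mul hX)).add (hasDerivAt_const (0 : ℝ) P)
    have h3 := h1.unique h2
    refine sylvester_eq_zero hX₀ hX₀ (posDef_closedLoop hX₀ hC₀ hP h₀)
      (posDef_closedLoop hX₀ hC₀ hP h₀) ?_
    rw [h3, Matrix.transpose_sub, Matrix.transpose_mul, hX₀.transpose_eq, hCs]
    simp only [zero_smul, add_zero, zero_mul, mul_zero, zero_add, Pi.mul_apply]
    noncomm_ring
  obtain ⟨ψ, hψ₀, hψ, hiff⟩ := exists_implicit_function hn hf hinj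
  refine ⟨ψ, hψ₀, hψ, ?_⟩
  have hfu : f (p₀, X₀) = 0 := h₀
  rw [hfu] at hiff
  have ht : Tendsto (fun p => (p, ψ p)) (𝓝 p₀) (𝓝 (p₀, X₀)) := by
    have := continuousAt_id.prodMk hψ.continuousAt
    rw [ContinuousAt, hψ₀] at this
    exact this
  -- The implicit function lives in the space of all matrices, so symmetry must be recovered: `(ψ
  -- p)ᵀ` also solves the equation and is close to `X₀`, so local uniqueness identifies it with `ψ
  -- p`.
  have ht' : Tendsto (fun p => (p, (ψ p)ᵀ)) (𝓝 p₀) (𝓝 (p₀, X₀)) := by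
    have := continuousAt_id.prodMk
      ((contDiff_transpose (n := 1)).continuous.continuousAt.comp hψ.continuousAt)
    rw [ContinuousAt, Function.comp_apply, hψ₀, hX₀.transpose_eq] at this
    exact this
  have htX : Tendsto ψ (𝓝 p₀) (𝓝 X₀) := by
    have := hψ.continuousAt
    rw [ContinuousAt, hψ₀] at this
    exact this
  filter_upwards [ht.eventually hiff, ht'.eventually hiff, htX.eventually (eventually_posDef hX₀)]
    with p h1 h2 h3
  have e1 : riccati (A p) (C p) P (ψ p) = 0 := h1.2 rfl
  have e2 : riccati (A p) (C p) P (ψ p)ᵀ = 0 := by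
    have := congrArg Matrix.transpose e1
    rw [riccati] at this ⊢
    simp only [Matrix.transpose_add, Matrix.transpose_sub, Matrix.transpose_mul, hCs,
      Matrix.transpose_transpose, hP.transpose_eq, Matrix.transpose_zero] at this
    rw [← this]; noncomm_ring
  have e3 : (ψ p)ᵀ = ψ p := (h2.1 e2).symm
  exact ⟨h3 ((Matrix.conjTranspose_eq_transpose_of_trivial _).trans e3), e1⟩

end Smooth

/-! ### The Riccati equation of a single system with a variable observation gain -/

section Block

variable {m : Type*} [Fintype m] [DecidableEq m]

theorem abs_apply_le_of_posSemidef {X : Matrix m m ℝ} (hX : X.PosSemidef) (i j : m) :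
    |X i j| ≤ (X i i + X j j) / 2 := by
  have hs : X j i = X i j := congrFun (congrFun hX.transpose_eq i) j
  have h1 := hX.dotProduct_mulVec_nonneg (Pi.single i 1 + Pi.single j 1)
  have h2 := hX.dotProduct_mulVec_nonneg (Pi.single i 1 - Pi.single j 1)
  simp only [star_trivial, Matrix.mulVec_add, Matrix.mulVec_sub, add_dotProduct, sub_dotProduct,
    dotProduct_add, dotProduct_sub, Matrix.mulVec_single_one, single_one_dotProduct,
    Matrix.col_apply, hs] at h1 h2
  rw [abs_le]
  constructor <;> linarith

omit [DecidableEq m] in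
-- On a kernel vector of `X`, the quadratic form of the Riccati expression reduces to that of `P`,
-- which is positive. Limits of solutions are therefore still definite.
theorem posDef_of_posSemidef_of_riccati {A C P X : Matrix m m ℝ} (hP : P.PosDef)
    (hX : X.PosSemidef) (h : riccati A C P X = 0) : X.PosDef := by
  refine Matrix.PosDef.of_dotProduct_mulVec_pos hX.isHermitian fun x hx => ?_
  refine lt_of_le_of_ne (hX.dotProduct_mulVec_nonneg x) fun h0 => ?_
  have hXx : X *ᵥ x = 0 := (hX.dotProduct_mulVec_zero_iff x).1 h0.symm
  have hxX : x ᵥ* X = 0 := by rw [← Matrix.mulVec_transpose, hX.transpose_eq, hXx]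
  have h1 : x ⬝ᵥ (riccati A C P X *ᵥ x) = 0 := by rw [h]; simp
  have h2 := hP.dotProduct_mulVec_pos hx
  rw [riccati] at h1
  simp only [Matrix.add_mulVec, Matrix.sub_mulVec, ← Matrix.mulVec_mulVec, hXx, Matrix.mulVec_zero,
    Matrix.dotProduct_mulVec, hxX, zero_dotProduct, sub_zero, zero_add, dotProduct_add,
    Matrix.dotProduct_mulVec x X, Matrix.zero_vecMul] at h1
  rw [star_trivial, Matrix.dotProduct_mulVec, h1] at h2
  exact lt_irrefl _ h2

/-- A priori bound for the continuation in `r`. For `r ≥ r₀` comparison gives `X ≤ X₀`; for `r ≤ r₀`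
the rescaled `r • X` solves the equation with fixed `C` and noise `r • P`, so `r • X ≤ r₀ • X₀`. The
factor `1 + r₀ / a` covers both cases. -/
theorem riccati_smul_diag_le {A C P X₀ X : Matrix m m ℝ} (hC : C.PosSemidef) (hP : P.PosDef)
    {a r₀ r : ℝ} (ha : 0 < a) (hr₀ : 0 < r₀) (har : a ≤ r) (hX₀ : X₀.PosDef) (hX : X.PosDef)
    (e₀ : riccati A (r₀ • C) P X₀ = 0) (e : riccati A (r • C) P X = 0) (i : m) :
    X i i ≤ (1 + r₀ / a) * X₀ i i := by
  have hr : 0 < r := ha.trans_le har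
  have h0 : 0 ≤ X₀ i i := hX₀.posSemidef.diag_nonneg
  have hd : 0 ≤ r₀ / a := by positivity
  rcases le_total r₀ r with h | h
  · have h1 := riccati_comparison (hC.smul hr₀.le) hP hX₀ hX e₀ e
      (by rw [← sub_smul]; exact hC.smul (sub_nonneg.2 h))
      (by rw [sub_self]; exact Matrix.PosSemidef.zero)
    have h2 := h1.diag_nonneg (i := i)
    rw [Matrix.sub_apply] at h2
    nlinarith
  · have scale : ∀ (s : ℝ) (Z : Matrix m m ℝ), riccati A (s • C) P Z = 0 →
        riccati A C (s • P) (s • Z) = 0 := by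
      intro s Z hZ
      have : riccati A C (s • P) (s • Z) = s • riccati A (s • C) P Z := by
        simp only [riccati, Matrix.mul_smul, Matrix.smul_mul, smul_add, smul_sub]
      rw [this, hZ, smul_zero]
    have h1 := riccati_comparison hC (hP.smul hr₀) (hX₀.smul hr₀) (hX.smul hr) (scale _ _ e₀)
      (scale _ _ e) (by rw [sub_self]; exact Matrix.PosSemidef.zero)
      (by rw [← sub_smul]; exact hP.posSemidef.smul (sub_nonneg.2 h))
    have h2 := h1.diag_nonneg (i := i)
    simp only [Matrix.sub_apply, Matrix.smul_apply, smul_eq_mul] at h2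
    have hXi : 0 ≤ X i i := hX.posSemidef.diag_nonneg
    have h3 : a * X i i ≤ r₀ * X₀ i i := by nlinarith
    have h4 : X i i ≤ r₀ / a * X₀ i i := by
      rw [div_mul_eq_mul_div, le_div_iff₀ ha]; linarith
    linarith

omit [DecidableEq m] in
theorem continuous_riccati_smul (A C P : Matrix m m ℝ) :
    Continuous fun z : ℝ × Matrix m m ℝ => riccati A (z.1 • C) P z.2 := by
  have h1 : Continuous fun z : ℝ × Matrix m m ℝ => z.2 := continuous_snd
  have h2 : Continuous fun z : ℝ × Matrix m m ℝ => z.1 • C := continuous_fst.smul continuous_const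
  exact (((continuous_const.matrix_mul h1).add (h1.matrix_mul continuous_const)).sub
    ((h1.matrix_mul h2).matrix_mul h1)).add continuous_const

/-- If the Riccati equation with observation gain `r` has a positive definite solution for one
gain `r₀ > 0`, then it has one for all gains `r > 0`. -/
theorem exists_riccati_smul_solution {A C P X₀ : Matrix m m ℝ} (hC : C.PosSemidef) (hP : P.PosDef)
    {r₀ : ℝ} (hr₀ : 0 < r₀) (hX₀ : X₀.PosDef) (e₀ : riccati A (r₀ • C) P X₀ = 0)
    {r : ℝ} (hr : 0 < r) : ∃ X : Matrix m m ℝ, X.PosDef ∧ riccati A (r • C) P X = 0 := by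
  -- Continuity method: the solvable gains form an open set by smooth continuation, relatively
  -- closed in `(0, ∞)` by compactness.
  set u : Set ℝ := {r | 0 < r ∧ ∃ X : Matrix m m ℝ, X.PosDef ∧ riccati A (r • C) P X = 0}
  suffices h : Ioi (0 : ℝ) ⊆ u from (h hr).2
  refine isPreconnected_Ioi.subset_of_closure_inter_subset ?_ ⟨r₀, hr₀, hr₀, X₀, hX₀, e₀⟩ ?_
  · rw [isOpen_iff_mem_nhds]
    rintro s ⟨hs, X, hX, e⟩
    open scoped Matrix.Norms.Operator in
    obtain ⟨ψ, -, -, h⟩ := exists_smooth_riccati_solution (E := ℝ) (n := 1) one_ne_zero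
      (A := fun _ => A) (C := fun t => t • C) (p₀ := s) contDiffAt_const
      (contDiffAt_id.smul contDiffAt_const)
      (fun t => by rw [Matrix.transpose_smul, hC.transpose_eq]) (hC.smul hs.le) hP hX e
    filter_upwards [h, lt_mem_nhds hs] with t ht ht0
    exact ⟨ht0, ψ t, ht⟩
  · rintro s ⟨hs, hs0⟩
    have hs0 : 0 < s := hs0
    refine ⟨hs0, ?_⟩
    -- Keeping gains above `s / 2` makes the a priori bound uniform near `s`.
    have ha : 0 < s / 2 := by positivity
    set K : ℝ := (1 + r₀ / (s / 2)) * ∑ k, X₀ k k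
    set B : Set (Matrix m m ℝ) :=
      (Set.univ.pi fun _ : m => Set.univ.pi fun _ : m => Icc (-K) K : Set (m → m → ℝ))
    have hB : IsCompact B := isCompact_univ_pi fun i => isCompact_univ_pi fun j => isCompact_Icc
    set Z : Set (ℝ × Matrix m m ℝ) := (Icc (s / 2) (s + 1) ×ˢ B) ∩
      ({z | z.2ᵀ = z.2} ∩ {z | ∀ x, 0 ≤ x ⬝ᵥ (z.2 *ᵥ x)} ∩ {z | riccati A (z.1 • C) P z.2 = 0})
    have hZ : IsCompact Z := by
      refine (isCompact_Icc.prod hB).inter_right ((IsClosed.inter ?_ ?_).inter ?_)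
      · exact isClosed_eq continuous_snd.matrix_transpose continuous_snd
      · simp only [Set.ofPred_forall]
        exact isClosed_iInter fun x => isClosed_le continuous_const
          (continuous_const.dotProduct (continuous_snd.matrix_mulVec continuous_const))
      · exact isClosed_eq (continuous_riccati_smul A C P) continuous_const
    have hcl : IsClosed (Prod.fst '' Z) := (hZ.image continuous_fst).isClosed
    have hmem : s ∈ Prod.fst '' Z := by
      rw [← hcl.closure_eq, mem_closure_iff_frequently]
      refine ((mem_closure_iff_frequently.1 hs).and_eventually
        (Icc_mem_nhds (show s / 2 < s by linarith) (show s < s + 1 by linarith))).mono ?_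
      rintro t ⟨⟨ht, X, hX, e⟩, htI⟩
      refine ⟨(t, X), ⟨⟨htI, fun i _ j _ => ?_⟩, ⟨hX.transpose_eq, fun x => ?_⟩, e⟩, rfl⟩
      · refine abs_le.1 ?_
        have hdiag : ∀ k, X k k ≤ K := fun k =>
          (riccati_smul_diag_le hC hP ha hr₀ htI.1 hX₀ hX e₀ e k).trans
            (mul_le_mul_of_nonneg_left (Finset.single_le_sum (f := fun k => X₀ k k)
              (fun k _ => hX₀.posSemidef.diag_nonneg) (Finset.mem_univ k)) (by positivity))
        have := abs_apply_le_of_posSemidef hX.posSemidef i j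
        linarith [hdiag i, hdiag j]
      · simpa using hX.posSemidef.dotProduct_mulVec_nonneg x
    obtain ⟨⟨t, X⟩, ⟨-, ⟨hXs, hXn⟩, e⟩, rfl⟩ := hmem
    refine ⟨X, posDef_of_posSemidef_of_riccati hP ?_ e, e⟩
    exact .of_dotProduct_mulVec_nonneg
      ((Matrix.conjTranspose_eq_transpose_of_trivial _).trans hXs) (by simpa using hXn)

/-- Positivity of the trace of the second derivative of the Riccati solution with respect to the
observation gain; the hypotheses are the first two derivatives of the Riccati equation. -/
theorem trace_second_derivative_pos {A C P X X₁ X₂ : Matrix m m ℝ} {r : ℝ} (hr : 0 ≤ r)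
    (hC : C.PosSemidef) (hC0 : C ≠ 0) (hP : P.PosDef) (hX : X.PosDef) (hX₁ : X₁ᵀ = X₁)
    (hX₂ : X₂ᵀ = X₂) (e₀ : riccati A (r • C) P X = 0)
    (e₁ : (A - X * (r • C)) * X₁ + X₁ * (A - X * (r • C))ᵀ = X * C * X)
    (e₂ : (A - X * (r • C)) * X₂ + X₂ * (A - X * (r • C))ᵀ =
      (2 : ℝ) • (X₁ * C * X + X * C * X₁ + X₁ * (r • C) * X₁)) :
    0 < X₂.trace := by
  have hstab := posDef_closedLoop hX (hC.smul hr) hP e₀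
  have hcl : (A - X * (r • C)) * X + X * (A - X * (r • C))ᵀ = -(P + X * (r • C) * X) := by
    rw [riccati] at e₀
    rw [Matrix.transpose_sub, Matrix.transpose_mul, hX.transpose_eq, Matrix.transpose_smul,
      hC.transpose_eq]
    have h' : P = -(A * X + X * Aᵀ - X * (r • C) * X) := (neg_eq_of_add_eq_zero_right e₀).symm
    rw [h']; noncomm_ring
  set F := A - X * (r • C)
  have hdet := (Matrix.isUnit_iff_isUnit_det _).1 hX.isUnit
  have u1 : X * X⁻¹ = 1 := Matrix.mul_nonsing_inv X hdet
  have u2 : X⁻¹ * X = 1 := Matrix.nonsing_inv_mul X hdet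
  -- With `Z = X⁻¹ * X₁`, set `V = X₁ * X⁻¹ * X₁ = Zᵀ * X * Z`. The Lyapunov equations for `X₂` and
  -- `V` differ so that `X₂ - 2 • V` has source `2 • Zᵀ * P * Z`, hence `X₂ ≥ 2 • V`; this amounts
  -- to concavity of `X⁻¹` in the gain.
  obtain ⟨Z, hZ⟩ : ∃ Z, X * Z = X₁ := ⟨X⁻¹ * X₁, by rw [← mul_assoc, u1, one_mul]⟩
  have hZt : Zᵀ * X = X₁ := by
    rw [← hX₁, ← hZ, Matrix.transpose_mul, hX.transpose_eq]
  have hne : X₁ ≠ 0 := by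
    rintro h
    rw [h, mul_zero, zero_mul, add_zero] at e₁
    apply hC0
    have : X⁻¹ * (X * C * X) * X⁻¹ = C := by
      rw [← mul_assoc, ← mul_assoc, u2, one_mul, mul_assoc, u1, mul_one]
    rw [← this, ← e₁, mul_zero, zero_mul]
  have hpos : 0 < (X₁ * X⁻¹ * X₁).trace := trace_conj_pos hX.inv hX₁ hne
  have hV : X₁ * X⁻¹ * X₁ = Zᵀ * X * Z := by
    rw [hZt, ← hZ, show X * Z * X⁻¹ * (X * Z) = X * Z * (X⁻¹ * X) * Z by
      simp only [mul_assoc], u2, mul_one]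
  rw [hV] at hpos
  have hFV : F * (Zᵀ * X * Z) + (Zᵀ * X * Z) * Fᵀ =
      X₁ * C * X + X * C * X₁ + X₁ * (r • C) * X₁ + Zᵀ * P * Z := by
    have a1 : F * (Zᵀ * X * Z) = (X * C * X - X₁ * Fᵀ) * Z := by
      rw [← e₁, add_sub_cancel_right, hZt, mul_assoc]
    have a2 : (Zᵀ * X * Z) * Fᵀ = Zᵀ * (X * C * X - F * X₁) := by
      rw [← e₁, add_sub_cancel_left, mul_assoc Zᵀ, hZ, mul_assoc]
    have a3 : X * C * X₁ = X * C * X * Z := by rw [mul_assoc (X * C) X Z, hZ]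
    have a4 : X₁ * C * X = Zᵀ * (X * C * X) := by rw [← hZt]; simp only [mul_assoc]
    have a5 : X₁ * (r • C) * X₁ + Zᵀ * P * Z = -(Zᵀ * (F * X + X * Fᵀ) * Z) := by
      rw [hcl]; nth_rewrite 2 [← hZ]; rw [← hZt]; noncomm_ring
    rw [a1, a2, a3, a4, add_assoc, a5]
    have a6 : X₁ * Fᵀ * Z = Zᵀ * (X * Fᵀ) * Z := by rw [← hZt]; simp only [mul_assoc]
    have a7 : Zᵀ * (F * X₁) = Zᵀ * (F * X) * Z := by rw [← hZ]; simp only [mul_assoc]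
    rw [sub_mul, mul_sub, a6, a7]
    noncomm_ring
  have hVt : (Zᵀ * X * Z)ᵀ = Zᵀ * X * Z := by
    simp only [Matrix.transpose_mul, Matrix.transpose_transpose, hX.transpose_eq, mul_assoc]
  have hW : (X₂ - (2 : ℝ) • (Zᵀ * X * Z)).PosSemidef := by
    refine lyapunov_posSemidef hX hstab ?_ ?_
    · rw [Matrix.transpose_sub, Matrix.transpose_smul, hX₂, hVt]
    · have : -(F * (X₂ - (2 : ℝ) • (Zᵀ * X * Z)) + (X₂ - (2 : ℝ) • (Zᵀ * X * Z)) * Fᵀ) =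
          (2 : ℝ) • (Zᵀ * P * Z) := by
        have : F * (X₂ - (2 : ℝ) • (Zᵀ * X * Z)) + (X₂ - (2 : ℝ) • (Zᵀ * X * Z)) * Fᵀ =
            (F * X₂ + X₂ * Fᵀ) - (2 : ℝ) • (F * (Zᵀ * X * Z) + (Zᵀ * X * Z) * Fᵀ) := by
          simp only [mul_sub, sub_mul, Matrix.mul_smul, Matrix.smul_mul, smul_add]
          abel
        rw [this, e₂, hFV, ← smul_sub, ← smul_neg]
        congr 1
        abel
      rw [this]
      refine Matrix.PosSemidef.smul ?_ (by norm_num)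
      simpa using hP.posSemidef.conjTranspose_mul_mul_same Z
  have h1 := hW.trace_nonneg
  rw [Matrix.trace_sub, Matrix.trace_smul, smul_eq_mul] at h1
  linarith

end Block

/-! ### Differentiating the single-system solution in the gain -/

section BlockSmooth

theorem differentiableAt_deriv_of_contDiffAt {G : Type*} [NormedAddCommGroup G] [NormedSpace ℝ G]
    {X : ℝ → G} {r : ℝ} (h : ContDiffAt ℝ 2 X r) : DifferentiableAt ℝ (deriv X) r := by
  have h1 : ContDiffAt ℝ 1 (fderiv ℝ X) r := h.fderiv_right (by norm_num)
  exact (h1.differentiableAt one_ne_zero).clm_apply (differentiableAt_const (1 : ℝ))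

open scoped Matrix.Norms.Operator

variable {m : Type*} [Fintype m]

theorem hasDerivAt_trace {X : ℝ → Matrix m m ℝ} {X' : Matrix m m ℝ} {r : ℝ}
    (h : HasDerivAt X X' r) : HasDerivAt (fun s => (X s).trace) X'.trace r :=
  (LinearMap.toContinuousLinearMap (Matrix.traceLinearMap m ℝ ℝ)).hasFDerivAt.comp_hasDerivAt r h

theorem hasDerivAt_transpose {X : ℝ → Matrix m m ℝ} {X' : Matrix m m ℝ} {r : ℝ}
    (h : HasDerivAt X X' r) : HasDerivAt (fun s => (X s)ᵀ) X'ᵀ r :=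
  (LinearMap.toContinuousLinearMap
    (Matrix.transposeLinearEquiv m m ℝ ℝ).toLinearMap).hasFDerivAt.comp_hasDerivAt r h

theorem contDiffAt_trace {E : Type*} [NormedAddCommGroup E] [NormedSpace ℝ E] {n : WithTop ℕ∞}
    {X : E → Matrix m m ℝ} {p : E} (h : ContDiffAt ℝ n X p) :
    ContDiffAt ℝ n (fun s => (X s).trace) p :=
  (LinearMap.toContinuousLinearMap (Matrix.traceLinearMap m ℝ ℝ)).contDiff.contDiffAt.comp p h

variable [DecidableEq m]

/-- By uniqueness, a pointwise chosen family of solutions agrees locally with the smooth branch. -/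
theorem contDiffAt_riccati_smul_solution {n : WithTop ℕ∞} (hn : n ≠ 0) {A C P : Matrix m m ℝ}
    {X : ℝ → Matrix m m ℝ} (hC : C.PosSemidef) (hP : P.PosDef)
    (hX : ∀ r, 0 < r → (X r).PosDef ∧ riccati A (r • C) P (X r) = 0) {r : ℝ} (hr : 0 < r) :
    ContDiffAt ℝ n X r := by
  obtain ⟨ψ, -, hψ, h⟩ := exists_smooth_riccati_solution (E := ℝ) hn
      (A := fun _ => A) (C := fun t => t • C) (p₀ := r) contDiffAt_const
      (contDiffAt_id.smul contDiffAt_const)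
      (fun t => by rw [Matrix.transpose_smul, hC.transpose_eq]) (hC.smul hr.le) hP (hX r hr).1
      (hX r hr).2
  refine hψ.congr_of_eventuallyEq ?_
  filter_upwards [h, lt_mem_nhds hr] with t ht ht0
  exact riccati_unique (hC.smul ht0.le) hP (hX t ht0).1 ht.1 (hX t ht0).2 ht.2

/-- The error `tr X(r)` of a single system is strictly convex in the observation gain `r`. -/
theorem deriv_deriv_trace_riccati_pos {A C P : Matrix m m ℝ}
    {X : ℝ → Matrix m m ℝ} (hC : C.PosSemidef) (hC0 : C ≠ 0) (hP : P.PosDef)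
    (hX : ∀ r, 0 < r → (X r).PosDef ∧ riccati A (r • C) P (X r) = 0) {r : ℝ} (hr : 0 < r) :
    0 < deriv (deriv fun s => (X s).trace) r := by
  have hcd : ∀ {s : ℝ}, 0 < s → ContDiffAt ℝ 2 X s := fun hs =>
    contDiffAt_riccati_smul_solution two_ne_zero hC hP hX hs
  have hd1 : ∀ s, 0 < s → HasDerivAt X (deriv X s) s := fun s hs =>
    ((hcd hs).differentiableAt two_ne_zero).hasDerivAt
  have hd2 : HasDerivAt (deriv X) (deriv (deriv X) r) r :=
    (differentiableAt_deriv_of_contDiffAt (hcd hr)).hasDerivAt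
  have sym1 : ∀ s, 0 < s → (deriv X s)ᵀ = deriv X s := by
    intro s hs
    refine HasDerivAt.unique ?_ (hd1 s hs)
    refine (hasDerivAt_transpose (hd1 s hs)).congr_of_eventuallyEq ?_
    filter_upwards [lt_mem_nhds hs] with t ht
    exact (hX t ht).1.transpose_eq.symm
  have sym2 : (deriv (deriv X) r)ᵀ = deriv (deriv X) r := by
    refine HasDerivAt.unique ?_ hd2
    refine (hasDerivAt_transpose hd2).congr_of_eventuallyEq ?_
    filter_upwards [lt_mem_nhds hr] with t ht
    exact (sym1 t ht).symm
  have hrC : ∀ s : ℝ, HasDerivAt (fun t : ℝ => t • C) C s := fun s => by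
    have h := (hasDerivAt_id s).smul_const C
    rw [one_smul] at h
    exact h
  have E1 : ∀ s, 0 < s → A * deriv X s + deriv X s * Aᵀ -
      ((deriv X s * (s • C) + X s * C) * X s + X s * (s • C) * deriv X s) = 0 := by
    intro s hs
    have h := ((((hasDerivAt_const s A).mul (hd1 s hs)).add
      ((hd1 s hs).mul (hasDerivAt_const s Aᵀ))).sub
      (((hd1 s hs).mul (hrC s)).mul (hd1 s hs))).add (hasDerivAt_const s P)
    have h0 := h.unique ((hasDerivAt_const s (0 : Matrix m m ℝ)).congr_of_eventuallyEq (by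
      filter_upwards [lt_mem_nhds hs] with t ht
      exact (hX t ht).2))
    simpa only [zero_mul, mul_zero, add_zero, zero_add, Pi.mul_apply] using h0
  have E2 : A * deriv (deriv X) r + deriv (deriv X) r * Aᵀ -
      ((deriv (deriv X) r * (r • C) + deriv X r * C + deriv X r * C) * X r +
        (deriv X r * (r • C) + X r * C) * deriv X r +
        ((deriv X r * (r • C) + X r * C) * deriv X r + X r * (r • C) * deriv (deriv X) r)) = 0 := by
    have h := (((hasDerivAt_const r A).mul hd2).add (hd2.mul (hasDerivAt_const r Aᵀ))).sub
      ((((hd2.mul (hrC r)).add ((hd1 r hr).mul (hasDerivAt_const r C))).mul (hd1 r hr)).add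
        (((hd1 r hr).mul (hrC r)).mul hd2))
    have h0 := h.unique ((hasDerivAt_const r (0 : Matrix m m ℝ)).congr_of_eventuallyEq (by
      filter_upwards [lt_mem_nhds hr] with t ht
      exact E1 t ht))
    simpa only [zero_mul, mul_zero, add_zero, zero_add, Pi.mul_apply, Pi.add_apply] using h0
  have hXt := (hX r hr).1.transpose_eq
  have key := trace_second_derivative_pos hr.le hC hC0 hP (hX r hr).1 (sym1 r hr) sym2 (hX r hr).2
    (by
      rw [Matrix.transpose_sub, Matrix.transpose_mul, hXt, Matrix.transpose_smul, hC.transpose_eq,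
        ← sub_eq_zero, ← E1 r hr]
      noncomm_ring)
    (by
      rw [Matrix.transpose_sub, Matrix.transpose_mul, hXt, Matrix.transpose_smul, hC.transpose_eq,
        ← sub_eq_zero, ← E2, two_smul]
      noncomm_ring)
  have hd : deriv (fun s => (X s).trace) =ᶠ[𝓝 r] fun s => (deriv X s).trace := by
    filter_upwards [lt_mem_nhds hr] with s hs
    exact (hasDerivAt_trace (hd1 s hs)).deriv
  rw [hd.deriv_eq, (hasDerivAt_trace hd2).deriv]
  exact key

end BlockSmooth

/-! ### Strictly diagonally dominant matrices -/

/-- A quantitative form of strict diagonal dominance: the diagonal entries are positive and each of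
them dominates `4 N` times each off-diagonal entry. -/
def DiagDominant {N : ℕ} (H : Fin N → Fin N → ℝ) : Prop :=
  (∀ k, 0 < H k k) ∧ ∀ i j k, i ≠ j → 4 * N * |H i j| < H k k

namespace DiagDominant

variable {N : ℕ} {H : Fin N → Fin N → ℝ}

/-- Each off-diagonal term is at most `(H i i * v i ^ 2 + H j j * v j ^ 2) / (4 * N)`; summed over
all pairs these cost half of the diagonal part. -/
theorem quadratic_pos (h : DiagDominant H) {v : Fin N → ℝ} (hv : v ≠ 0) :
    0 < ∑ i, v i * ∑ j, H i j * v j := by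
  obtain ⟨k, hk⟩ := Function.ne_iff.1 hv
  have hN : (0 : ℝ) < N := by exact_mod_cast k.pos
  have hS : 0 < ∑ i, H i i * v i ^ 2 :=
    Finset.sum_pos' (fun i _ => mul_nonneg (h.1 i).le (sq_nonneg _))
      ⟨k, Finset.mem_univ k, mul_pos (h.1 k) (sq_pos_of_ne_zero hk)⟩
  have hij : ∀ i j, (if i = j then H i i * v i ^ 2 else 0) -
      (H i i * v i ^ 2 + H j j * v j ^ 2) / (4 * N) ≤ v i * (H i j * v j) := by
    intro i j
    split_ifs with hij
    · subst hij
      have : 0 ≤ (H i i * v i ^ 2 + H i i * v i ^ 2) / (4 * N) := by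
        have := h.1 i; positivity
      nlinarith
    · have h1 := h.2 i j i hij
      have h2 := h.2 i j j hij
      have h3 : 4 * N * |H i j| * (2 * |v i * v j|) ≤ H i i * v i ^ 2 + H j j * v j ^ 2 := by
        have h4 : 2 * |v i * v j| ≤ v i ^ 2 + v j ^ 2 := by
          rw [abs_mul, ← sq_abs (v i), ← sq_abs (v j)]
          nlinarith [sq_nonneg (|v i| - |v j|)]
        have h5 : 0 ≤ 4 * N * |H i j| := by positivity
        nlinarith [sq_nonneg (v i), sq_nonneg (v j), mul_le_mul_of_nonneg_left h4 h5,
          mul_le_mul_of_nonneg_right h1.le (sq_nonneg (v i)),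
          mul_le_mul_of_nonneg_right h2.le (sq_nonneg (v j))]
      have h6 : |v i * (H i j * v j)| ≤ (H i i * v i ^ 2 + H j j * v j ^ 2) / (4 * N) := by
        rw [le_div_iff₀ (by positivity), show v i * (H i j * v j) = H i j * (v i * v j) by ring,
          abs_mul]
        have : 0 ≤ 4 * N * |H i j| * |v i * v j| := by positivity
        linarith
      rw [zero_sub]
      exact (abs_le.1 h6).1
  have hsum := Finset.sum_le_sum fun i (_ : i ∈ Finset.univ) =>
    Finset.sum_le_sum fun j (_ : j ∈ Finset.univ) => hij i j
  have hl : ∑ i, ∑ j, ((if i = j then H i i * v i ^ 2 else 0) -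
      (H i i * v i ^ 2 + H j j * v j ^ 2) / (4 * N)) = (1 / 2) * ∑ i, H i i * v i ^ 2 := by
    simp only [Finset.sum_sub_distrib, Finset.sum_ite_eq, Finset.mem_univ, if_true,
      ← Finset.sum_div, Finset.sum_add_distrib, Finset.sum_const, Finset.card_univ,
      Fintype.card_fin, nsmul_eq_mul, ← Finset.mul_sum]
    field_simp
    ring
  rw [hl] at hsum
  simp only [← Finset.mul_sum] at hsum
  linarith

/-- Let `|v k|` be maximal; then `k ∈ J`. Since dominance compares with every diagonal entry, the
off-diagonal part of any row is at most `H k k * |v k| / 4`. Row `k` gives `H k k * |v k| ≤ 4 * lam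
/ 3`, so the off-diagonal parts stay below `lam` and `H i i * v i > 0`. -/
theorem solution_pos (h : DiagDominant H) {v : Fin N → ℝ} {J : Set (Fin N)} {lam : ℝ}
    (hlam : 0 < lam) (hJ : ∀ i ∈ J, ∑ j, H i j * v j = lam) (hJ' : ∀ i ∉ J, v i = 0)
    {i : Fin N} (hi : i ∈ J) : 0 < v i := by
  have hN : (0 : ℝ) < N := by exact_mod_cast i.pos
  obtain ⟨k, -, hk⟩ := Finset.exists_max_image Finset.univ (fun k => |v k|) ⟨i, Finset.mem_univ i⟩
  have hdecomp : ∀ a, ∑ j, H a j * v j = H a a * v a + ∑ j ∈ Finset.univ.erase a, H a j * v j :=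
    fun a => (Finset.add_sum_erase _ _ (Finset.mem_univ a)).symm
  have hoff : ∀ a, |∑ j ∈ Finset.univ.erase a, H a j * v j| ≤ H k k * |v k| / 4 := by
    intro a
    have h1 : ∀ j ∈ Finset.univ.erase a, |H a j * v j| ≤ H k k * |v k| / (4 * N) := by
      intro j hj
      have hne : a ≠ j := (Finset.ne_of_mem_erase hj).symm
      rw [abs_mul, le_div_iff₀ (by positivity)]
      have h2 := h.2 a j k hne
      have h3 := hk j (Finset.mem_univ j)
      have h4 : 4 * N * |H a j| * |v j| ≤ H k k * |v k| :=
        mul_le_mul h2.le h3 (abs_nonneg _) (h.1 k).le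
      linarith
    refine (Finset.abs_sum_le_sum_abs _ _).trans ((Finset.sum_le_sum h1).trans ?_)
    have hc : ((Finset.univ.erase a).card : ℝ) ≤ N := by
      exact_mod_cast (Finset.card_erase_le).trans (by simp)
    have hp : 0 ≤ H k k * |v k| / (4 * N) := by have := h.1 k; positivity
    rw [Finset.sum_const, nsmul_eq_mul]
    refine (mul_le_mul_of_nonneg_right hc hp).trans (le_of_eq ?_)
    field_simp
  have hkJ : k ∈ J := by
    by_contra hkJ
    have hk0 := hJ' k hkJ
    have hv : ∀ j, v j = 0 := fun j => by
      have := hk j (Finset.mem_univ j)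
      rw [hk0, abs_zero] at this
      exact abs_nonpos_iff.1 this
    have := hJ i hi
    simp only [hv, mul_zero, Finset.sum_const_zero] at this
    exact hlam.ne this
  have hbound : H k k * |v k| * (3 / 4) ≤ lam := by
    have h1 := hJ k hkJ
    rw [hdecomp] at h1
    have h2 : H k k * |v k| ≤ lam + H k k * |v k| / 4 := by
      have h3 : |H k k * v k| = H k k * |v k| := by rw [abs_mul, abs_of_pos (h.1 k)]
      have h4 := hoff k
      rw [← h3] at h4 ⊢
      calc |H k k * v k| = |lam + -∑ j ∈ Finset.univ.erase k, H k j * v j| := by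
            rw [eq_sub_of_add_eq h1, sub_eq_add_neg]
        _ ≤ _ := (abs_add_le _ _).trans
            (add_le_add (abs_of_pos hlam).le (by rwa [abs_neg]))
    linarith
  have h1 := hJ i hi
  rw [hdecomp] at h1
  have h2 := (abs_le.1 (hoff i)).2
  have h3 : 0 < H i i * v i := by linarith
  exact pos_of_mul_pos_right h3 (h.1 i).le

end DiagDominant

/-! ### Simplices -/

section Simplex

variable {N : ℕ}

theorem mem_Ch {σmax : ℝ} {v : Fin N → ℝ} :
    v ∈ Ch N σmax ↔ (∀ i, 0 ≤ v i) ∧ ∑ i, v i ≤ σmax := by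
  simp only [Ch, Sp, Set.mem_iUnion, Set.mem_ofPred_eq, exists_prop]
  constructor
  · rintro ⟨σ, hσ, h0, hs⟩
    exact ⟨h0, hs.trans_le hσ.2⟩
  · rintro ⟨h0, hs⟩
    exact ⟨_, ⟨Finset.sum_nonneg fun i _ => h0 i, hs⟩, h0, rfl⟩

theorem Sp_subset_Ch {σ σmax : ℝ} (h : σ ≤ σmax) : Sp N σ ⊆ Ch N σmax :=
  fun _ hv => mem_Ch.2 ⟨hv.1, hv.2.trans_le h⟩

theorem isCompact_Ch (σmax : ℝ) : IsCompact (Ch N σmax) := by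
  have : Ch N σmax = Icc 0 (fun _ => σmax) ∩ {v | ∑ i, v i ≤ σmax} := by
    ext v
    rw [mem_Ch]
    refine ⟨fun h => ⟨⟨h.1, fun i => ?_⟩, h.2⟩, fun h => ⟨h.1.1, h.2⟩⟩
    exact (Finset.single_le_sum (fun j _ => h.1 j) (Finset.mem_univ i)).trans h.2
  rw [this]
  exact isCompact_Icc.inter_right (isClosed_le (by fun_prop) continuous_const)

theorem convex_Ch (σmax : ℝ) : Convex ℝ (Ch N σmax) := by
  have : Ch N σmax = {v | ∀ i, 0 ≤ v i} ∩ {v | ∑ i, v i ≤ σmax} := by ext v; exact mem_Ch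
  rw [this]
  refine Convex.inter ?_ ?_
  · intro x hx y hy a b ha hb _ i
    exact add_nonneg (mul_nonneg ha (hx i)) (mul_nonneg hb (hy i))
  · refine convex_halfSpace_le (f := fun v : Fin N → ℝ => ∑ i, v i) ⟨?_, ?_⟩ _
    · intro x y; simp [Finset.sum_add_distrib]
    · intro a x; simp [Finset.mul_sum]

theorem isCompact_Sp (σ : ℝ) : IsCompact (Sp N σ) := by
  have : Sp N σ = Ch N σ ∩ {v | ∑ i, v i = σ} := by
    ext v
    exact ⟨fun h => ⟨Sp_subset_Ch le_rfl h, h.2⟩, fun h => ⟨(mem_Ch.1 h.1).1, h.2⟩⟩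
  rw [this]
  exact (isCompact_Ch σ).inter_right (isClosed_eq (by fun_prop) continuous_const)

theorem convex_Sp (σ : ℝ) : Convex ℝ (Sp N σ) := by
  intro x hx y hy a b ha hb hab
  refine ⟨fun i => ?_, ?_⟩
  · exact add_nonneg (mul_nonneg ha (hx.1 i)) (mul_nonneg hb (hy.1 i))
  · simp only [Pi.add_apply, Pi.smul_apply, smul_eq_mul, Finset.sum_add_distrib, ← Finset.mul_sum,
      hx.2, hy.2]
    rw [← add_mul, hab, one_mul]

theorem nonempty_Sp (hN : 1 ≤ N) {σ : ℝ} (hσ : 0 ≤ σ) : (Sp N σ).Nonempty := by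
  refine ⟨Pi.single ⟨0, hN⟩ σ, fun i => ?_, by simp⟩
  rcases eq_or_ne i ⟨0, hN⟩ with rfl | h
  · simpa using hσ
  · simp [h]

end Simplex

/-! ### Gradient and Hessian of the error -/

section Optimization

variable {N : ℕ} {η : (Fin N → ℝ) → ℝ}

/-- The partial derivative `∂η / ∂γ_i`. -/
def partialDeriv (η : (Fin N → ℝ) → ℝ) (i : Fin N) (x : Fin N → ℝ) : ℝ :=
  fderiv ℝ η x (Pi.single i 1)

/-- The Hessian of `η`. -/
def hessian (η : (Fin N → ℝ) → ℝ) (x : Fin N → ℝ) (i j : Fin N) : ℝ :=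
  partialDeriv (partialDeriv η i) j x

theorem fderiv_eq_sum_partialDeriv (η : (Fin N → ℝ) → ℝ) (x v : Fin N → ℝ) :
    fderiv ℝ η x v = ∑ i, v i * partialDeriv η i x := by
  conv_lhs => rw [pi_eq_sum_univ' v]
  simp [partialDeriv, map_sum]

theorem contDiffAt_partialDeriv {x : Fin N → ℝ} (h : ContDiffAt ℝ 2 η x) (i : Fin N) :
    ContDiffAt ℝ 1 (partialDeriv η i) x := by
  have h1 : ContDiffAt ℝ 1 (fderiv ℝ η) x := h.fderiv_right (by norm_num)
  exact h1.clm_apply contDiffAt_const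

theorem hasDerivAt_comp_partial {g : (Fin N → ℝ) → ℝ} {c : ℝ → Fin N → ℝ} {v : Fin N → ℝ} {t : ℝ}
    (hg : DifferentiableAt ℝ g (c t)) (hc : HasDerivAt c v t) :
    HasDerivAt (fun s => g (c s)) (∑ j, v j * partialDeriv g j (c t)) t := by
  rw [← fderiv_eq_sum_partialDeriv]
  exact hg.hasFDerivAt.comp_hasDerivAt t hc

theorem hasDerivAt_partialDeriv_comp {c : ℝ → Fin N → ℝ} {v : Fin N → ℝ} {t : ℝ}
    (hη : ContDiffAt ℝ 2 η (c t)) (hc : HasDerivAt c v t) (i : Fin N) :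
    HasDerivAt (fun s => partialDeriv η i (c s)) (∑ j, hessian η (c t) i j * v j) t := by
  have h := hasDerivAt_comp_partial
    ((contDiffAt_partialDeriv hη i).differentiableAt one_ne_zero) hc
  simpa only [hessian, mul_comm] using h

/-- Along the segment from `x` to `y` the derivative of `η` starts nonnegative and strictly
increases. -/
theorem lt_of_fderiv_nonneg {K : Set (Fin N → ℝ)} (hK : Convex ℝ K)
    (hη : ∀ x ∈ K, ContDiffAt ℝ 2 η x) (hH : ∀ x ∈ K, DiagDominant (hessian η x))
    {x y : Fin N → ℝ} (hx : x ∈ K) (hy : y ∈ K) (hne : y ≠ x)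
    (hd : 0 ≤ ∑ i, (y - x) i * partialDeriv η i x) : η x < η y := by
  set v := y - x with hv
  have hv0 : v ≠ 0 := sub_ne_zero.2 hne
  set c : ℝ → Fin N → ℝ := fun t => x + t • v
  have hc : ∀ t, HasDerivAt c v t := fun t => by
    have h := ((hasDerivAt_id t).smul_const v).const_add x
    rwa [one_smul] at h
  have hcK : ∀ t ∈ Icc (0 : ℝ) 1, c t ∈ K := fun t ht => hK.add_smul_sub_mem hx hy ht
  set φ' : ℝ → ℝ := fun t => ∑ i, v i * partialDeriv η i (c t)
  have h1 : ∀ t ∈ Icc (0 : ℝ) 1, HasDerivAt (fun t => η (c t)) (φ' t) t := fun t ht =>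
    hasDerivAt_comp_partial ((hη _ (hcK t ht)).differentiableAt two_ne_zero) (hc t)
  have h2 : ∀ t ∈ Icc (0 : ℝ) 1,
      HasDerivAt φ' (∑ i, v i * ∑ j, hessian η (c t) i j * v j) t := fun t ht =>
    HasDerivAt.fun_sum fun i _ =>
      (hasDerivAt_partialDeriv_comp (hη _ (hcK t ht)) (hc t) i).const_mul (v i)
  have hmono : StrictMonoOn φ' (Icc 0 1) := by
    refine strictMonoOn_of_deriv_pos (convex_Icc 0 1)
      (fun t ht => (h2 t ht).continuousAt.continuousWithinAt) fun t ht => ?_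
    have ht' := interior_subset ht
    rw [(h2 t ht').deriv]
    exact (hH _ (hcK t ht')).quadratic_pos hv0
  have h00 : 0 ≤ φ' 0 := by simpa [φ', c] using hd
  have hmono' : StrictMonoOn (fun t => η (c t)) (Icc 0 1) := by
    refine strictMonoOn_of_deriv_pos (convex_Icc 0 1)
      (fun t ht => (h1 t ht).continuousAt.continuousWithinAt) fun t ht => ?_
    have ht' := interior_subset ht
    rw [(h1 t ht').deriv]
    rw [interior_Icc] at ht
    exact h00.trans_lt (hmono (by simp) ht' ht.1)
  have := hmono' (a := 0) (b := 1) (by simp) (by simp) one_pos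
  simpa [c, hv] using this

/-- The Karush-Kuhn-Tucker conditions with multiplier `μ` at a point of a simplex. -/
def KKT (η : (Fin N → ℝ) → ℝ) (x : Fin N → ℝ) (μ : ℝ) : Prop :=
  (∀ i, 0 < x i → partialDeriv η i x = μ) ∧ ∀ i, μ ≤ partialDeriv η i x

theorem KKT.sum_nonneg {x y : Fin N → ℝ} {μ σ : ℝ} (h : KKT η x μ) (hx : x ∈ Sp N σ)
    (hy : y ∈ Sp N σ) : 0 ≤ ∑ i, (y - x) i * partialDeriv η i x := by
  have h1 : ∀ i, (y - x) i * μ ≤ (y - x) i * partialDeriv η i x := by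
    intro i
    rcases (hx.1 i).eq_or_lt with hi | hi
    · refine mul_le_mul_of_nonneg_left (h.2 i) ?_
      rw [Pi.sub_apply, ← hi, sub_zero]
      exact hy.1 i
    · rw [h.1 i hi]
  have h2 : ∑ i, (y - x) i * μ = 0 := by
    rw [← Finset.sum_mul]
    simp only [Pi.sub_apply, Finset.sum_sub_distrib, hx.2, hy.2, sub_self, zero_mul]
  rw [← h2]
  exact Finset.sum_le_sum fun i _ => h1 i

/-- Transferring the whole allocation of `i` to `j` stays in the simplex, so the derivative in that
direction is nonnegative. -/
theorem partialDeriv_le_of_isMinOn {x : Fin N → ℝ} {σ : ℝ} (hx : x ∈ Sp N σ)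
    (hmin : IsMinOn η (Sp N σ) x) (hd : DifferentiableAt ℝ η x) {i : Fin N} (hi : 0 < x i)
    (j : Fin N) : partialDeriv η i x ≤ partialDeriv η j x := by
  rcases eq_or_ne i j with rfl | hij
  · exact le_rfl
  set y : Fin N → ℝ := x + x i • (Pi.single j 1 - Pi.single i 1) with hy
  have hyS : y ∈ Sp N σ := by
    refine ⟨fun k => ?_, ?_⟩
    · have := hx.1 k
      rcases eq_or_ne k i with rfl | hki
      · simp [hy, hij]
      · rcases eq_or_ne k j with rfl | hkj
        · simp [hy, hki]; positivity
        · simpa [hy, hki, hkj] using this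
    · simp [hy, Finset.sum_add_distrib, ← Finset.mul_sum, hx.2]
  have h1 := hmin.localize.hasFDerivWithinAt_nonneg hd.hasFDerivAt.hasFDerivWithinAt
    (sub_mem_posTangentConeAt_of_segment_subset ((convex_Sp σ).segment_subset hx hyS))
  rw [hy, add_sub_cancel_left, map_smul, map_sub, smul_eq_mul] at h1
  exact sub_nonneg.1 (nonneg_of_mul_nonneg_right h1 hi)

/-- The multiplier is the smallest partial derivative, hence the largest admissible one, and it is
attained at an index. This fits the convention at `σ = 0`. -/
theorem exists_KKT_of_isMinOn (hN : 1 ≤ N) {x : Fin N → ℝ} {σ : ℝ} (hx : x ∈ Sp N σ)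
    (hmin : IsMinOn η (Sp N σ) x) (hd : DifferentiableAt ℝ η x) :
    ∃ k, KKT η x (partialDeriv η k x) := by
  obtain ⟨k, -, hk⟩ := Finset.exists_min_image Finset.univ (fun k => partialDeriv η k x)
    ⟨⟨0, hN⟩, Finset.mem_univ _⟩
  exact ⟨k, fun i hi => le_antisymm (partialDeriv_le_of_isMinOn hx hmin hd hi k)
    (hk i (Finset.mem_univ i)), fun i => hk i (Finset.mem_univ i)⟩

end Optimization

/-! ### Active-set equations and the curve of KKT points -/

section Curve

variable {N : ℕ} {η : (Fin N → ℝ) → ℝ}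

open scoped Classical in
/-- The equations satisfied by an allocation `x` with multiplier `μ` and total resource `σ` whose
support is contained in `J`, all of whose indices have partial derivative `μ`. -/
def activeSystem (η : (Fin N → ℝ) → ℝ) (J : Set (Fin N)) (z : ℝ × ((Fin N → ℝ) × ℝ)) :
    (Fin N → ℝ) × ℝ :=
  (fun i => if i ∈ J then partialDeriv η i z.2.1 - z.2.2 else z.2.1 i, ∑ i, z.2.1 i - z.1)

theorem activeSystem_eq_zero_iff {J : Set (Fin N)} {s μ : ℝ} {x : Fin N → ℝ} :
    activeSystem η J (s, x, μ) = 0 ↔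
      (∀ i ∈ J, partialDeriv η i x = μ) ∧ (∀ i ∉ J, x i = 0) ∧ ∑ i, x i = s := by
  simp only [activeSystem, Prod.mk_eq_zero, funext_iff, Pi.zero_apply, sub_eq_zero]
  constructor
  · rintro ⟨h1, h2⟩
    refine ⟨fun i hi => ?_, fun i hi => ?_, h2⟩
    · have := h1 i; rwa [if_pos hi, sub_eq_zero] at this
    · have := h1 i; rwa [if_neg hi] at this
  · rintro ⟨h1, h2, h3⟩
    refine ⟨fun i => ?_, h3⟩
    split_ifs with hi
    · rw [h1 i hi, sub_self]
    · exact h2 i hi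

theorem contDiffAt_activeSystem {J : Set (Fin N)} {s μ : ℝ} {x : Fin N → ℝ}
    (hη : ContDiffAt ℝ 2 η x) : ContDiffAt ℝ 1 (activeSystem η J) (s, x, μ) := by
  refine ContDiffAt.prodMk (contDiffAt_pi.2 fun i => ?_) ?_
  · have h1 : ContDiffAt ℝ 1 (fun z : ℝ × ((Fin N → ℝ) × ℝ) => z.2.1) (s, x, μ) := by fun_prop
    by_cases hi : i ∈ J
    · simp only [hi, if_true]
      have h2 : ContDiffAt ℝ 1 (fun z : ℝ × ((Fin N → ℝ) × ℝ) => partialDeriv η i z.2.1)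
          (s, x, μ) := ContDiffAt.comp (s, x, μ) (g := partialDeriv η i)
        (contDiffAt_partialDeriv hη i) h1
      exact h2.sub (by fun_prop)
    · simp only [hi, if_false]
      fun_prop
  · fun_prop

/-- The equations satisfied by a direction in the kernel of the derivative of `activeSystem`. -/
theorem active_of_fderiv_activeSystem_eq_zero {J : Set (Fin N)} {s μ : ℝ} {x : Fin N → ℝ}
    (hη : ContDiffAt ℝ 2 η x) {v : Fin N → ℝ} {w : ℝ}
    (h : fderiv ℝ (activeSystem η J) (s, x, μ) (0, v, w) = 0) :
    (∀ i ∈ J, ∑ j, hessian η x i j * v j = w) ∧ (∀ i ∉ J, v i = 0) ∧ ∑ i, v i = 0 := by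
  set c : ℝ → Fin N → ℝ := fun t => x + t • v
  have hc : HasDerivAt c v 0 := by
    have h := ((hasDerivAt_id (0 : ℝ)).smul_const v).const_add x
    rwa [one_smul] at h
  have hμ : HasDerivAt (fun t : ℝ => μ + t * w) w 0 := by
    have h := ((hasDerivAt_id (0 : ℝ)).mul_const w).const_add μ
    rwa [one_mul] at h
  have hc0 : c 0 = x := by simp [c]
  have hl : HasDerivAt (fun t => (s, c t, μ + t * w)) (0, v, w) 0 :=
    (hasDerivAt_const _ _).prodMk (hc.prodMk hμ)
  have hF : HasFDerivAt (activeSystem η J) (fderiv ℝ (activeSystem η J) (s, x, μ))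
      (s, c 0, μ + 0 * w) := by
    rw [hc0, zero_mul, add_zero]
    exact ((contDiffAt_activeSystem hη).differentiableAt one_ne_zero).hasFDerivAt
  have h1 := hF.comp_hasDerivAt (0 : ℝ) hl
  rw [h] at h1
  have h2 : ∀ i, HasDerivAt (fun t => (activeSystem η J (s, c t, μ + t * w)).1 i) 0 0 :=
    (hasDerivAt_pi (φ := fun t => (activeSystem η J (s, c t, μ + t * w)).1) (φ' := 0)).1
      ((ContinuousLinearMap.fst ℝ (Fin N → ℝ) ℝ).hasFDerivAt.comp_hasDerivAt (0 : ℝ) h1)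
  have h2' : HasDerivAt (fun t => (activeSystem η J (s, c t, μ + t * w)).2) 0 0 :=
    (ContinuousLinearMap.snd ℝ (Fin N → ℝ) ℝ).hasFDerivAt.comp_hasDerivAt (0 : ℝ) h1
  refine ⟨fun i hi => ?_, fun i hi => ?_, ?_⟩
  · have h3 := (hasDerivAt_partialDeriv_comp (c := c) (by rwa [hc0]) hc i).sub hμ
    have h4 := h2 i
    simp only [activeSystem, hi, if_true] at h4
    have h5 := h4.unique h3
    rw [hc0] at h5
    exact (sub_eq_zero.1 h5.symm)
  · have h4 := h2 i
    simp only [activeSystem, hi, if_false] at h4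
    exact (hasDerivAt_pi.1 hc i).unique h4
  · have h3 : HasDerivAt (fun t => ∑ i, c t i - s) (∑ i, v i) 0 :=
      (HasDerivAt.fun_sum fun i _ => hasDerivAt_pi.1 hc i).sub_const s
    exact h3.unique h2'

/-- Used with total `0` to show that the linearised active system is injective, and with total `1`
to find the sign of the multiplier's derivative. -/
theorem sum_mul_eq_of_active {J : Set (Fin N)} {H : Fin N → Fin N → ℝ} {v : Fin N → ℝ} {w : ℝ}
    (h₁ : ∀ i ∈ J, ∑ j, H i j * v j = w) (h₂ : ∀ i ∉ J, v i = 0) :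
    ∑ i, v i * ∑ j, H i j * v j = (∑ i, v i) * w := by
  rw [Finset.sum_mul]
  refine Finset.sum_congr rfl fun i _ => ?_
  by_cases hi : i ∈ J
  · rw [h₁ i hi]
  · rw [h₂ i hi, zero_mul, zero_mul]

theorem eventually_pos_of_hasDerivAt {g : ℝ → ℝ} {g' s : ℝ} (h : HasDerivAt g g' s) (hg' : 0 < g')
    (h0 : 0 ≤ g s) : ∀ᶠ t in 𝓝[>] s, 0 < g t := by
  have h1 : Tendsto (slope g s) (𝓝[>] s) (𝓝 g') :=
    h.tendsto_slope.mono_left (nhdsWithin_mono _ fun t ht => (ne_of_gt ht : t ≠ s))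
  filter_upwards [h1.eventually (lt_mem_nhds hg'), self_mem_nhdsWithin] with t ht hst
  have hst' : 0 < t - s := sub_pos.2 hst
  rw [slope_def_field] at ht
  have := (div_pos_iff_of_pos_right hst').1 ht
  linarith

/-- Through a point satisfying the Karush-Kuhn-Tucker conditions there is, to the right, a smooth
curve of such points parametrized by the total resource. -/
theorem exists_KKT_curve {x₀ : Fin N → ℝ} {μ₀ σ₀ : ℝ} (hη : ContDiffAt ℝ 2 η x₀)
    (hH : DiagDominant (hessian η x₀)) (hx₀ : x₀ ∈ Sp N σ₀) (hk : KKT η x₀ μ₀)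
    (hJ : ∃ k, partialDeriv η k x₀ = μ₀) :
    ∃ c : ℝ → Fin N → ℝ, c σ₀ = x₀ ∧ ContDiffAt ℝ 1 c σ₀ ∧
      (∀ i, partialDeriv η i x₀ = μ₀ → 0 < deriv c σ₀ i) ∧
      (∀ i, partialDeriv η i x₀ ≠ μ₀ → deriv c σ₀ i = 0) ∧
      ∀ᶠ σ in 𝓝[≥] σ₀, c σ ∈ Sp N σ ∧ ∃ μ, KKT η (c σ) μ := by
  set J : Set (Fin N) := {i | partialDeriv η i x₀ = μ₀}
  have hinj : ∀ y, fderiv ℝ (activeSystem η J) (σ₀, x₀, μ₀) (0, y) = 0 → y = 0 := by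
    rintro ⟨v, w⟩ hvw
    obtain ⟨h1, h2, h3⟩ := active_of_fderiv_activeSystem_eq_zero hη hvw
    have hq := sum_mul_eq_of_active h1 h2
    rw [h3, zero_mul] at hq
    have hv : v = 0 := by
      by_contra hv
      exact (hH.quadratic_pos hv).ne' hq
    obtain ⟨k, hkJ⟩ := hJ
    have hw := h1 k hkJ
    simp only [hv, Pi.zero_apply, mul_zero, Finset.sum_const_zero] at hw
    rw [hv, ← hw]; rfl
  obtain ⟨ψ, hψ₀, hψ, hiff⟩ := exists_implicit_function one_ne_zero
    (contDiffAt_activeSystem (J := J) (s := σ₀) (μ := μ₀) hη) hinj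
  have h0 : activeSystem η J (σ₀, x₀, μ₀) = 0 := by
    refine activeSystem_eq_zero_iff.2 ⟨fun i hi => hi, fun i hi => ?_, hx₀.2⟩
    by_contra hne
    exact hi (hk.1 i (lt_of_le_of_ne (hx₀.1 i) (Ne.symm hne)))
  rw [h0] at hiff
  have hψ₀ : ψ σ₀ = (x₀, μ₀) := hψ₀
  have hψ : ContDiffAt ℝ 1 ψ σ₀ := hψ
  set c : ℝ → Fin N → ℝ := fun σ => (ψ σ).1
  set μ : ℝ → ℝ := fun σ => (ψ σ).2
  have hc₀ : c σ₀ = x₀ := congrArg Prod.fst hψ₀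
  have hμ₀ : μ σ₀ = μ₀ := congrArg Prod.snd hψ₀
  have hc : ContDiffAt ℝ 1 c σ₀ := hψ.fst
  have hμ : ContDiffAt ℝ 1 μ σ₀ := hψ.snd
  have hdc : HasDerivAt c (deriv c σ₀) σ₀ := (hc.differentiableAt one_ne_zero).hasDerivAt
  have hdμ : HasDerivAt μ (deriv μ σ₀) σ₀ := (hμ.differentiableAt one_ne_zero).hasDerivAt
  have hsol : ∀ᶠ σ in 𝓝 σ₀, (∀ i ∈ J, partialDeriv η i (c σ) = μ σ) ∧ (∀ i ∉ J, c σ i = 0) ∧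
      ∑ i, c σ i = σ := by
    have ht : Tendsto (fun σ => (σ, ψ σ)) (𝓝 σ₀) (𝓝 (σ₀, x₀, μ₀)) := by
      rw [← hψ₀]
      exact (continuousAt_id.prodMk hψ.continuousAt)
    filter_upwards [ht.eventually hiff] with σ hσ
    exact activeSystem_eq_zero_iff.1 (hσ.2 rfl)
  have hη' : ContDiffAt ℝ 2 η (c σ₀) := by rwa [hc₀]
  have e1 : ∀ i ∈ J, ∑ j, hessian η x₀ i j * deriv c σ₀ j = deriv μ σ₀ := by
    intro i hi
    have h := hasDerivAt_partialDeriv_comp hη' hdc i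
    rw [hc₀] at h
    exact h.unique (hdμ.congr_of_eventuallyEq (hsol.mono fun σ hσ => hσ.1 i hi))
  have e2 : ∀ i ∉ J, deriv c σ₀ i = 0 := by
    intro i hi
    exact (hasDerivAt_pi.1 hdc i).unique ((hasDerivAt_const σ₀ (0 : ℝ)).congr_of_eventuallyEq
      (hsol.mono fun σ hσ => hσ.2.1 i hi))
  have e3 : ∑ i, deriv c σ₀ i = 1 :=
    (HasDerivAt.fun_sum fun i _ => hasDerivAt_pi.1 hdc i).unique
      ((hasDerivAt_id σ₀).congr_of_eventuallyEq (hsol.mono fun σ hσ => hσ.2.2))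
  have hw : 0 < deriv μ σ₀ := by
    have hq := sum_mul_eq_of_active e1 e2
    rw [e3, one_mul] at hq
    rw [← hq]
    refine hH.quadratic_pos fun h => ?_
    rw [h] at e3
    simp at e3
  have hpos : ∀ i, i ∈ J → 0 < deriv c σ₀ i := fun i hi => hH.solution_pos hw e1 e2 hi
  refine ⟨c, hc₀, hc, hpos, e2, ?_⟩
  -- Only one-sided: an index of `J` with zero allocation at `σ₀` becomes positive to the right
  -- because its derivative is positive.
  have hnn : ∀ᶠ σ in 𝓝[≥] σ₀, ∀ i, 0 ≤ c σ i := by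
    rw [← Ioi_insert, nhdsWithin_insert, eventually_sup, eventually_pure]
    refine ⟨fun i => by rw [hc₀]; exact hx₀.1 i, eventually_all.2 fun i => ?_⟩
    by_cases hi : i ∈ J
    · exact (eventually_pos_of_hasDerivAt (hasDerivAt_pi.1 hdc i) (hpos i hi)
        (by rw [hc₀]; exact hx₀.1 i)).mono fun σ hσ => hσ.le
    · exact (hsol.filter_mono nhdsWithin_le_nhds).mono fun σ hσ => (hσ.2.1 i hi).ge
  have hstrict : ∀ᶠ σ in 𝓝 σ₀, ∀ i, i ∉ J → μ σ < partialDeriv η i (c σ) := by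
    refine eventually_all.2 fun i => ?_
    by_cases hi : i ∈ J
    · exact Eventually.of_forall fun σ h => absurd hi h
    · have hp : ContinuousAt (fun σ => partialDeriv η i (c σ)) σ₀ :=
        (hasDerivAt_partialDeriv_comp hη' hdc i).continuousAt
      refine (hμ.continuousAt.eventually_lt hp ?_).mono fun σ h _ => h
      rw [hμ₀, hc₀]
      exact lt_of_le_of_ne (hk.2 i) (Ne.symm hi)
  filter_upwards [hnn, hsol.filter_mono nhdsWithin_le_nhds,
    hstrict.filter_mono nhdsWithin_le_nhds] with σ h1 h2 h3
  refine ⟨⟨h1, h2.2.2⟩, μ σ, fun i hi => ?_, fun i => ?_⟩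
  · by_cases hiJ : i ∈ J
    · exact h2.1 i hiJ
    · exact absurd (h2.2.1 i hiJ) hi.ne'
  · by_cases hiJ : i ∈ J
    · exact (h2.1 i hiJ).ge
    · exact (h3 i hiJ).le

/-- Sensitivity of the optimal allocation map. -/
theorem rightDeriv_of_isMinOn {σmax σ₀ μ₀ : ℝ} {f : ℝ → Fin N → ℝ}
    (hη : ∀ x ∈ Ch N σmax, ContDiffAt ℝ 2 η x)
    (hH : ∀ x ∈ Ch N σmax, DiagDominant (hessian η x))
    (hf : ∀ σ ∈ Icc 0 σmax, f σ ∈ Sp N σ ∧ IsMinOn η (Sp N σ) (f σ)) (hσ₀ : σ₀ ∈ Ico 0 σmax)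
    (hk : KKT η (f σ₀) μ₀) (hJ : ∃ k, partialDeriv η k (f σ₀) = μ₀) :
    HasDerivWithinAt f (rightDeriv f σ₀) (Ioi σ₀) σ₀ ∧
      ContinuousWithinAt (rightDeriv f) (Ioi σ₀) σ₀ ∧
      (∀ i, partialDeriv η i (f σ₀) = μ₀ → 0 < rightDeriv f σ₀ i) ∧
      (∀ i, partialDeriv η i (f σ₀) ≠ μ₀ → rightDeriv f σ₀ i = 0) := by
  obtain ⟨hf₀, -⟩ := hf σ₀ ⟨hσ₀.1, hσ₀.2.le⟩
  have hf₀C := Sp_subset_Ch hσ₀.2.le hf₀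
  obtain ⟨c, hc₀, hc, hpos, hzero, hev⟩ :=
    exists_KKT_curve (hη _ hf₀C) (hH _ hf₀C) hf₀ hk hJ
  -- Strict convexity leaves no minimizer other than the KKT point `c σ`. Agreement on a whole right
  -- neighbourhood also yields right-continuity of the derivative.
  have heq : ∀ᶠ σ in 𝓝[≥] σ₀, f σ = c σ ∧ ContDiffAt ℝ 1 c σ := by
    filter_upwards [hev, self_mem_nhdsWithin,
      (gt_mem_nhds hσ₀.2).filter_mono nhdsWithin_le_nhds,
      (hc.eventually (by simp)).filter_mono nhdsWithin_le_nhds] with σ hσ hle hlt hcd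
    refine ⟨?_, hcd⟩
    by_contra hne
    obtain ⟨hcS, μ, hkσ⟩ := hσ
    obtain ⟨hfS, hmin⟩ := hf σ ⟨hσ₀.1.trans hle, hlt.le⟩
    have := lt_of_fderiv_nonneg (convex_Ch σmax) hη hH (Sp_subset_Ch hlt.le hcS) (Sp_subset_Ch hlt.le hfS) hne
      (hkσ.sum_nonneg hcS hfS)
    exact not_le_of_gt this (hmin hcS)
  obtain ⟨u, hu, hsub⟩ := mem_nhdsGE_iff_exists_Ico_subset.1 heq
  have hd : ∀ σ ∈ Ico σ₀ u, HasDerivWithinAt f (deriv c σ) (Ioi σ) σ := by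
    intro σ hσ
    have h1 := ((hsub hσ).2.differentiableAt one_ne_zero).hasDerivAt.hasDerivWithinAt (s := Ioi σ)
    refine h1.congr_of_eventuallyEq ?_ (hsub hσ).1
    filter_upwards [Ioo_mem_nhdsGT hσ.2] with τ hτ
    exact (hsub ⟨hσ.1.trans hτ.1.le, hτ.2⟩).1
  have hr : ∀ σ ∈ Ico σ₀ u, rightDeriv f σ = deriv c σ := fun σ hσ =>
    (hd σ hσ).derivWithin (uniqueDiffWithinAt_Ioi σ)
  have hσu : σ₀ ∈ Ico σ₀ u := ⟨le_rfl, hu⟩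
  rw [hr σ₀ hσu]
  refine ⟨hd σ₀ hσu, ?_, fun i hi => hpos i hi, fun i hi => hzero i hi⟩
  have hcont : ContinuousAt (deriv c) σ₀ := by
    have h1 : ContDiffAt ℝ 0 (fderiv ℝ c) σ₀ := hc.fderiv_right (by norm_num)
    exact h1.continuousAt.clm_apply continuousAt_const
  refine hcont.continuousWithinAt.congr_of_eventuallyEq ?_ (hr σ₀ hσu)
  filter_upwards [Ioo_mem_nhdsGT hu] with τ hτ
  exact hr τ ⟨hτ.1.le, hτ.2⟩

end Curve

/-! ### Networks of weakly coupled systems -/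

theorem posDef_blockDiagonal {m o : Type*} [Fintype m] [DecidableEq m] [Fintype o] [DecidableEq o]
    {M : o → Matrix m m ℝ} (h : ∀ i, (M i).PosDef) : (Matrix.blockDiagonal M).PosDef := by
  choose L hL hM using fun i => (h i).exists_eq_transpose_mul_self
  have e : Matrix.blockDiagonal M = (Matrix.blockDiagonal L)ᴴ * Matrix.blockDiagonal L := by
    rw [Matrix.conjTranspose_eq_transpose_of_trivial, Matrix.blockDiagonal_transpose,
      ← Matrix.blockDiagonal_mul]
    exact congrArg _ (funext hM)
  rw [e]
  refine Matrix.PosDef.conjTranspose_mul_self _ (Matrix.mulVec_injective_iff_isUnit.2 ?_)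
  refine IsUnit.of_mul_eq_one (Matrix.blockDiagonal fun i => (L i)⁻¹) ?_
  rw [← Matrix.blockDiagonal_mul, ← Matrix.blockDiagonal_one]
  exact congrArg _ (funext fun i =>
    Matrix.mul_nonsing_inv _ ((Matrix.isUnit_iff_isUnit_det _).1 (hL i)))

theorem ne_zero_of_observable {m q : Type*} [Fintype m] [DecidableEq m] [Nonempty m] [Fintype q]
    {A : Matrix m m ℝ} {c : Matrix m q ℝ} (h : Observable A c) : c ≠ 0 := by
  rintro rfl
  have h0 : controllabilityMatrix Aᵀ (0 : Matrix m q ℝ) = 0 := by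
    ext i j
    simp [controllabilityMatrix]
  rw [Observable, Controllable, h0, Matrix.rank_zero] at h
  exact Fintype.card_ne_zero h.symm

/-! ### Hessians of slices and of separable functions -/

section Partial

variable {N : ℕ}

theorem partialDeriv_slice {g : ℝ × (Fin N → ℝ) → ℝ} {ε : ℝ} {x : Fin N → ℝ}
    (h : DifferentiableAt ℝ g (ε, x)) (i : Fin N) :
    partialDeriv (fun y => g (ε, y)) i x = fderiv ℝ g (ε, x) (0, Pi.single i 1) := by
  have h1 : HasFDerivAt (fun y : Fin N → ℝ => (ε, y)) (ContinuousLinearMap.inr ℝ ℝ (Fin N → ℝ)) x :=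
    hasFDerivAt_prodMk_right ε x
  have h2 := HasFDerivAt.comp (g := g) x h.hasFDerivAt h1
  exact DFunLike.congr_fun h2.fderiv (Pi.single i 1)

theorem hessian_slice {g : ℝ × (Fin N → ℝ) → ℝ} {ε : ℝ} {x : Fin N → ℝ}
    (h : ContDiffAt ℝ 2 g (ε, x)) (i j : Fin N) :
    hessian (fun y => g (ε, y)) x i j =
      fderiv ℝ (fun z => fderiv ℝ g z (0, Pi.single i 1)) (ε, x) (0, Pi.single j 1) := by
  have h1 : ContDiffAt ℝ 1 (fderiv ℝ g) (ε, x) := h.fderiv_right (by norm_num)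
  have h2 : DifferentiableAt ℝ (fun z => fderiv ℝ g z (0, Pi.single i 1)) (ε, x) :=
    (h1.differentiableAt one_ne_zero).clm_apply (differentiableAt_const _)
  have h3 : partialDeriv (fun y => g (ε, y)) i =ᶠ[𝓝 x]
      fun y => fderiv ℝ g (ε, y) (0, Pi.single i 1) := by
    have ht : Tendsto (fun y : Fin N → ℝ => (ε, y)) (𝓝 x) (𝓝 (ε, x)) :=
      (Continuous.prodMk_right ε).continuousAt
    filter_upwards [ht.eventually (h.eventually (by simp))] with y hy
    exact partialDeriv_slice (hy.differentiableAt two_ne_zero) i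
  rw [hessian, partialDeriv, h3.fderiv_eq]
  exact partialDeriv_slice (g := fun z => fderiv ℝ g z (0, Pi.single i 1)) h2 j

/-- Continuity is joint in `ε` and `γ`, which is what lets diagonal dominance pass from `ε = 0` to
small `ε`. -/
theorem continuousAt_hessian_slice {g : ℝ × (Fin N → ℝ) → ℝ} {z₀ : ℝ × (Fin N → ℝ)}
    (h : ContDiffAt ℝ 2 g z₀) (i j : Fin N) :
    ContinuousAt (fun z : ℝ × (Fin N → ℝ) => hessian (fun y => g (z.1, y)) z.2 i j) z₀ := by
  have h1 : ContDiffAt ℝ 1 (fun z => fderiv ℝ g z (0, Pi.single i 1)) z₀ :=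
    (h.fderiv_right (m := 1) (by norm_num)).clm_apply contDiffAt_const
  have h2 : ContDiffAt ℝ 0
      (fun z => fderiv ℝ (fun z => fderiv ℝ g z (0, Pi.single i 1)) z (0, Pi.single j 1)) z₀ :=
    (h1.fderiv_right (m := 0) (by norm_num)).clm_apply contDiffAt_const
  refine h2.continuousAt.congr ?_
  filter_upwards [h.eventually (by simp)] with z hz
  exact (hessian_slice hz i j).symm

theorem partialDeriv_coordinate {t : ℝ → ℝ} {a : ℝ} {x : Fin N → ℝ} {i : Fin N}
    (h : DifferentiableAt ℝ t (x i + a)) (j : Fin N) :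
    partialDeriv (fun y => t (y i + a)) j x = if i = j then deriv t (x i + a) else 0 := by
  have h1 : HasFDerivAt (fun y : Fin N → ℝ => y i + a) (ContinuousLinearMap.proj (R := ℝ) i) x :=
    (hasFDerivAt_apply i x).add_const a
  have h2 := HasDerivAt.comp_hasFDerivAt (f := fun y : Fin N → ℝ => y i + a) x h.hasDerivAt h1
  have h3 := DFunLike.congr_fun h2.fderiv (Pi.single j 1)
  refine h3.trans ?_
  by_cases hij : i = j
  · subst hij; simp
  · simp [hij]

theorem partialDeriv_sum_coordinate {t : Fin N → ℝ → ℝ} {a : ℝ} {x : Fin N → ℝ}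
    (h : ∀ i, DifferentiableAt ℝ (t i) (x i + a)) (j : Fin N) :
    partialDeriv (fun y => ∑ i, t i (y i + a)) j x = deriv (t j) (x j + a) := by
  have hd : ∀ i, DifferentiableAt ℝ (fun y : Fin N → ℝ => t i (y i + a)) x := fun i =>
    DifferentiableAt.comp (g := t i) x (h i) ((differentiableAt_apply i x).add_const a)
  have h1 : partialDeriv (fun y => ∑ i, t i (y i + a)) j x =
      ∑ i, partialDeriv (fun y => t i (y i + a)) j x := by
    rw [partialDeriv, fderiv_fun_sum fun i _ => hd i]
    simp [partialDeriv]
  rw [h1]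
  simp only [partialDeriv_coordinate (h _), Finset.sum_ite_eq', Finset.mem_univ, if_true]

end Partial

namespace Network

variable {N n p : ℕ} (S : Network N n p)

/-- The information matrix `c_γ c_γᵀ` of the network, as an affine function of `γ`. -/
def infoMatrix (rmin : ℝ) (γ : Fin N → ℝ) : Matrix (Fin n × Fin N) (Fin n × Fin N) ℝ :=
  ∑ i, (γ i + rmin) • Matrix.blockDiagonal (Pi.single i (S.c i * (S.c i)ᵀ))

theorem infoMatrix_eq (rmin : ℝ) (γ : Fin N → ℝ) :
    S.infoMatrix rmin γ = Matrix.blockDiagonal fun i => (γ i + rmin) • (S.c i * (S.c i)ᵀ) := by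
  ext ⟨a, i⟩ ⟨b, j⟩
  rw [infoMatrix, Matrix.sum_apply]
  simp only [Matrix.smul_apply, Matrix.blockDiagonal_apply, smul_eq_mul]
  by_cases hij : i = j
  · subst hij
    simp only [if_true]
    rw [Finset.sum_eq_single i]
    · simp
    · intro k _ hk
      rw [Pi.single_eq_of_ne hk.symm]; simp
    · simp
  · simp [hij]

theorem cγ_mul_transpose {rmin : ℝ} {γ : Fin N → ℝ} (h : ∀ i, 0 ≤ γ i + rmin) :
    S.cγ rmin γ * (S.cγ rmin γ)ᵀ = S.infoMatrix rmin γ := by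
  rw [infoMatrix_eq, cγ, Matrix.blockDiagonal_transpose, ← Matrix.blockDiagonal_mul]
  congr 1
  funext i
  rw [Matrix.transpose_smul, Matrix.smul_mul, Matrix.mul_smul, smul_smul, Real.mul_self_sqrt (h i)]

theorem posSemidef_infoMatrix {rmin : ℝ} {γ : Fin N → ℝ} (h : ∀ i, 0 ≤ γ i + rmin) :
    (S.infoMatrix rmin γ).PosSemidef := by
  rw [← S.cγ_mul_transpose h]
  simpa using Matrix.posSemidef_self_mul_conjTranspose (S.cγ rmin γ)

theorem transpose_infoMatrix (rmin : ℝ) (γ : Fin N → ℝ) :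
    (S.infoMatrix rmin γ)ᵀ = S.infoMatrix rmin γ := by
  rw [infoMatrix_eq, Matrix.blockDiagonal_transpose]
  congr 1
  funext i
  rw [Matrix.transpose_smul, Matrix.transpose_mul, Matrix.transpose_transpose]

theorem isCov_iff {rmin ε : ℝ} {γ : Fin N → ℝ} (h : ∀ i, 0 ≤ γ i + rmin)
    {X : Matrix (Fin n × Fin N) (Fin n × Fin N) ℝ} :
    S.IsCov rmin ε γ X ↔
      X.PosDef ∧ riccati (S.bigA ε) (S.infoMatrix rmin γ) (S.bigG * S.bigGᵀ) X = 0 := by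
  rw [IsCov, IsPosDefAREsol, S.cγ_mul_transpose h, riccati]

theorem bigA_zero : S.bigA 0 = Matrix.blockDiagonal S.A := by
  ext ⟨a, i⟩ ⟨b, j⟩
  by_cases hij : i = j
  · subst hij; simp [bigA, Matrix.blockDiagonal_apply]
  · simp [bigA, Matrix.blockDiagonal_apply, hij]

theorem bigA_eq (ε : ℝ) : S.bigA ε = S.bigA 0 + ε • (S.bigA 1 - S.bigA 0) := by
  ext ⟨a, i⟩ ⟨b, j⟩
  by_cases hij : i = j
  · simp [bigA, hij]
  · simp [bigA, hij]

theorem isCov_blockDiagonal {rmin : ℝ} {γ : Fin N → ℝ} (h : ∀ i, 0 < γ i + rmin)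
    {X : Fin N → ℝ → Matrix (Fin n) (Fin n) ℝ} (hX : ∀ i r, 0 < r → (X i r).PosDef ∧
      riccati (S.A i) (r • (S.c i * (S.c i)ᵀ)) (S.G i * (S.G i)ᵀ) (X i r) = 0) :
    S.IsCov rmin 0 γ (Matrix.blockDiagonal fun i => X i (γ i + rmin)) := by
  rw [S.isCov_iff fun i => (h i).le]
  refine ⟨posDef_blockDiagonal fun i => (hX i _ (h i)).1, ?_⟩
  rw [riccati, bigA_zero, infoMatrix_eq, bigG]
  simp only [Matrix.blockDiagonal_transpose, ← Matrix.blockDiagonal_mul,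
    ← Matrix.blockDiagonal_add, ← Matrix.blockDiagonal_sub]
  rw [← Matrix.blockDiagonal_zero]
  exact congrArg Matrix.blockDiagonal (funext fun i => (hX i _ (h i)).2)

section Assumption

variable {S} (hS : S.SubsystemAssumption)

include hS

theorem posDef_noise : (S.bigG * S.bigGᵀ).PosDef := by
  rw [bigG, Matrix.blockDiagonal_transpose, ← Matrix.blockDiagonal_mul]
  exact posDef_blockDiagonal fun i => (hS i).2.2.2.1

theorem isCov_unique {rmin ε : ℝ} {γ : Fin N → ℝ} (h : ∀ i, 0 ≤ γ i + rmin)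
    {X Y : Matrix (Fin n × Fin N) (Fin n × Fin N) ℝ} (hX : S.IsCov rmin ε γ X)
    (hY : S.IsCov rmin ε γ Y) : X = Y := by
  rw [S.isCov_iff h] at hX hY
  exact riccati_unique (S.posSemidef_infoMatrix h) (posDef_noise hS) hX.1 hY.1 hX.2 hY.2

/-- Existence makes the `Classical.epsilon` choice in `cov` a genuine solution, and uniqueness makes
it the given one. -/
theorem η_eq_trace {rmin ε : ℝ} {γ : Fin N → ℝ} (h : ∀ i, 0 ≤ γ i + rmin)
    {X : Matrix (Fin n × Fin N) (Fin n × Fin N) ℝ} (hX : S.IsCov rmin ε γ X) :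
    S.η rmin ε γ = X.trace := by
  have hcov : S.IsCov rmin ε γ (S.cov rmin ε γ) := Classical.epsilon_spec ⟨X, hX⟩
  rw [η, isCov_unique hS h hcov hX]

theorem exists_subsystem_solution : ∃ X : Fin N → ℝ → Matrix (Fin n) (Fin n) ℝ,
    ∀ i r, 0 < r → (X i r).PosDef ∧
      riccati (S.A i) (r • (S.c i * (S.c i)ᵀ)) (S.G i * (S.G i)ᵀ) (X i r) = 0 := by
  have h : ∀ (i : Fin N) (r : ℝ), ∃ Y : Matrix (Fin n) (Fin n) ℝ, 0 < r → Y.PosDef ∧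
      riccati (S.A i) (r • (S.c i * (S.c i)ᵀ)) (S.G i * (S.G i)ᵀ) Y = 0 := by
    intro i r
    by_cases hr : 0 < r
    · obtain ⟨-, hP, r₀, hr₀, X₀, ⟨hX₀, e₀⟩, -⟩ := (hS i).2.2
      have hC : (S.c i * (S.c i)ᵀ).PosSemidef := by
        simpa using Matrix.posSemidef_self_mul_conjTranspose (S.c i)
      have hcc : √r₀ • S.c i * (√r₀ • S.c i)ᵀ = r₀ • (S.c i * (S.c i)ᵀ) := by
        rw [Matrix.transpose_smul, Matrix.smul_mul, Matrix.mul_smul, smul_smul,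
          Real.mul_self_sqrt hr₀.le]
      rw [hcc] at e₀
      obtain ⟨Y, hY⟩ := exists_riccati_smul_solution hC hP hr₀ hX₀ e₀ hr
      exact ⟨Y, fun _ => hY⟩
    · exact ⟨0, fun h => absurd h hr⟩
  choose X hX using h
  exact ⟨X, hX⟩

open scoped Matrix.Norms.Operator in
/-- Near a decoupled network, the error covariance exists and the error is smooth. -/
theorem eventually_isCov {rmin : ℝ} {γ₀ : Fin N → ℝ} (h : ∀ i, 0 < γ₀ i + rmin) :
    ContDiffAt ℝ 2 (fun z : ℝ × (Fin N → ℝ) => S.η rmin z.1 z.2) (0, γ₀) ∧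
      ∀ᶠ z : ℝ × (Fin N → ℝ) in 𝓝 (0, γ₀), ∃ X, S.IsCov rmin z.1 z.2 X := by
  obtain ⟨X, hX⟩ := exists_subsystem_solution hS
  have h0 := S.isCov_blockDiagonal h hX
  rw [S.isCov_iff fun i => (h i).le] at h0
  have hA : ContDiffAt ℝ 2 (fun z : ℝ × (Fin N → ℝ) => S.bigA z.1) (0, γ₀) := by
    have e : (fun z : ℝ × (Fin N → ℝ) => S.bigA z.1) =
        fun z => S.bigA 0 + z.1 • (S.bigA 1 - S.bigA 0) := funext fun z => S.bigA_eq z.1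
    rw [e]
    exact contDiffAt_const.add (contDiffAt_fst.smul contDiffAt_const)
  have hC : ContDiffAt ℝ 2 (fun z : ℝ × (Fin N → ℝ) => S.infoMatrix rmin z.2) (0, γ₀) := by
    have hc : ∀ i, ContDiffAt ℝ 2 (fun z : ℝ × (Fin N → ℝ) => z.2 i + rmin) (0, γ₀) := fun i => by
      fun_prop
    exact ContDiffAt.sum fun i _ => (hc i).smul contDiffAt_const
  obtain ⟨ψ, -, hψ, hev⟩ := exists_smooth_riccati_solution (E := ℝ × (Fin N → ℝ)) two_ne_zero
    hA hC (fun z => S.transpose_infoMatrix rmin z.2)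
    (S.posSemidef_infoMatrix fun i => (h i).le) (posDef_noise hS) h0.1 h0.2
  have hpos : ∀ᶠ z : ℝ × (Fin N → ℝ) in 𝓝 (0, γ₀), ∀ i, 0 < z.2 i + rmin := by
    refine eventually_all.2 fun i => ?_
    have hc : Continuous fun z : ℝ × (Fin N → ℝ) => z.2 i + rmin := by fun_prop
    exact hc.continuousAt.eventually (lt_mem_nhds (h i))
  have hcov : ∀ᶠ z : ℝ × (Fin N → ℝ) in 𝓝 (0, γ₀), S.IsCov rmin z.1 z.2 (ψ z) := by
    filter_upwards [hev, hpos] with z hz hz'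
    exact (S.isCov_iff fun i => (hz' i).le).2 hz
  refine ⟨(contDiffAt_trace hψ).congr_of_eventuallyEq ?_, hcov.mono fun z hz => ⟨_, hz⟩⟩
  filter_upwards [hcov, hpos] with z hz hz'
  exact η_eq_trace hS (fun i => (hz' i).le) hz

/-- The Hessian of the error of a decoupled network is diagonal and positive definite. -/
theorem diagDominant_hessian_zero (hn : 1 ≤ n) {rmin : ℝ} {γ : Fin N → ℝ}
    (h : ∀ i, 0 < γ i + rmin) : DiagDominant (hessian (S.η rmin 0) γ) := by
  obtain ⟨X, hX⟩ := exists_subsystem_solution hS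
  have hC : ∀ i, (S.c i * (S.c i)ᵀ).PosSemidef := fun i => by
    simpa using Matrix.posSemidef_self_mul_conjTranspose (S.c i)
  have hC0 : ∀ i, S.c i * (S.c i)ᵀ ≠ 0 := fun i h0 => by
    have : Nonempty (Fin n) := ⟨⟨0, hn⟩⟩
    refine ne_zero_of_observable (hS i).1 ?_
    rwa [← Matrix.conjTranspose_eq_transpose_of_trivial, Matrix.self_mul_conjTranspose_eq_zero]
      at h0
  set t : Fin N → ℝ → ℝ := fun i r => (X i r).trace
  have ht : ∀ i r, 0 < r → ContDiffAt ℝ 2 (t i) r := fun i r hr => by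
    open scoped Matrix.Norms.Operator in
    exact contDiffAt_trace
      (contDiffAt_riccati_smul_solution two_ne_zero (hC i) (hS i).2.2.2.1 (hX i) hr)
  have hpos : ∀ {γ : Fin N → ℝ}, (∀ i, 0 < γ i + rmin) →
      ∀ᶠ x in 𝓝 γ, ∀ i, 0 < x i + rmin := fun {γ} h => by
    refine eventually_all.2 fun i => ?_
    have hc : Continuous fun x : Fin N → ℝ => x i + rmin := by fun_prop
    exact hc.continuousAt.eventually (lt_mem_nhds (h i))
  have hη : ∀ {x : Fin N → ℝ}, (∀ i, 0 < x i + rmin) → S.η rmin 0 x = ∑ i, t i (x i + rmin) := by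
    intro x hx
    rw [η_eq_trace hS (fun i => (hx i).le) (S.isCov_blockDiagonal hx hX),
      Matrix.trace_blockDiagonal]
  have hgrad : ∀ {x : Fin N → ℝ}, (∀ i, 0 < x i + rmin) → ∀ i,
      partialDeriv (S.η rmin 0) i x = deriv (t i) (x i + rmin) := by
    intro x hx i
    have e : S.η rmin 0 =ᶠ[𝓝 x] fun y => ∑ i, t i (y i + rmin) :=
      (hpos hx).mono fun y hy => hη hy
    rw [partialDeriv, e.fderiv_eq]
    exact partialDeriv_sum_coordinate
      (fun i => (ht i _ (hx i)).differentiableAt two_ne_zero) i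
  have hhess : ∀ i j, hessian (S.η rmin 0) γ i j =
      if i = j then deriv (deriv (t i)) (γ i + rmin) else 0 := by
    intro i j
    have e : partialDeriv (S.η rmin 0) i =ᶠ[𝓝 γ] fun y => deriv (t i) (y i + rmin) :=
      (hpos h).mono fun y hy => hgrad hy i
    rw [hessian, partialDeriv, e.fderiv_eq]
    exact partialDeriv_coordinate (differentiableAt_deriv_of_contDiffAt (ht i _ (h i))) j
  have hdiag : ∀ k, 0 < hessian (S.η rmin 0) γ k k := by
    intro k
    rw [hhess, if_pos rfl]
    exact deriv_deriv_trace_riccati_pos (hC k) (hC0 k) (hS k).2.2.2.1 (hX k) (h k)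
  refine ⟨hdiag, fun i j k hij => ?_⟩
  rw [hhess i j, if_neg hij, abs_zero, mul_zero]
  exact hdiag k

/-- All three properties are open: dominance consists of finitely many strict inequalities between
continuous Hessian entries, valid at `ε = 0`. -/
theorem eventually_regular (hn : 1 ≤ n) {rmin : ℝ} {γ₀ : Fin N → ℝ} (h : ∀ i, 0 < γ₀ i + rmin) :
    ∀ᶠ z : ℝ × (Fin N → ℝ) in 𝓝 (0, γ₀), (∃ X, S.IsCov rmin z.1 z.2 X) ∧
      ContDiffAt ℝ 2 (S.η rmin z.1) z.2 ∧ DiagDominant (hessian (S.η rmin z.1) z.2) := by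
  obtain ⟨hcd, hcov⟩ := eventually_isCov hS h
  have hcont := continuousAt_hessian_slice hcd
  have h0 := diagDominant_hessian_zero hS hn h
  have h1 : ∀ᶠ z : ℝ × (Fin N → ℝ) in 𝓝 (0, γ₀), ∀ k, 0 < hessian (S.η rmin z.1) z.2 k k :=
    eventually_all.2 fun k => (hcont k k).eventually (lt_mem_nhds (h0.1 k))
  have h2 : ∀ᶠ z : ℝ × (Fin N → ℝ) in 𝓝 (0, γ₀), ∀ i j k, i ≠ j →
      4 * N * |hessian (S.η rmin z.1) z.2 i j| < hessian (S.η rmin z.1) z.2 k k := by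
    refine eventually_all.2 fun i => eventually_all.2 fun j => eventually_all.2 fun k => ?_
    by_cases hij : i = j
    · exact Eventually.of_forall fun z hne => absurd hij hne
    · have hlt := ((hcont i j).abs.const_mul (4 * (N : ℝ))).eventually_lt (hcont k k) (h0.2 i j k hij)
      exact hlt.mono fun z hz _ => hz
  filter_upwards [hcov, hcd.eventually (by simp), h1, h2] with z hz hz' hz1 hz2
  refine ⟨hz, ?_, hz1, hz2⟩
  exact ContDiffAt.comp (g := fun z : ℝ × (Fin N → ℝ) => S.η rmin z.1 z.2)
    (f := fun y => (z.1, y)) z.2 hz' (contDiffAt_const.prodMk contDiffAt_id)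

end Assumption

end Network

end

end OptAlloc

theorem mainTheorem8 {N n p : ℕ} (hN : 1 ≤ N) (hn : 1 ≤ n) (S : OptAlloc.Network N n p)
    (hS : S.SubsystemAssumption) (rmin : ℝ) (hrmin : 0 < rmin) (σmax : ℝ) (hσmax : 0 < σmax) :
    ∃ ε₀ : ℝ, 0 < ε₀ ∧ ∀ ε : ℝ, |ε| ≤ ε₀ →
      -- the error `η` is well defined and differentiable on `Ch[σ_max]`
      (∀ γ ∈ OptAlloc.Ch N σmax,
        (∃! X, S.IsCov rmin ε γ X) ∧ DifferentiableAt ℝ (S.η rmin ε) γ) ∧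
      -- `f(σ)` is the unique minimizer of `η` on `Sp[σ]`, and `μ_σ` is the KKT multiplier
      (∀ σ ∈ Set.Icc 0 σmax,
        S.f rmin ε σ ∈ OptAlloc.Sp N σ ∧
        (∀ γ ∈ OptAlloc.Sp N σ, γ ≠ S.f rmin ε σ →
          S.η rmin ε (S.f rmin ε σ) < S.η rmin ε γ) ∧
        IsGreatest {μ | S.IsKKTMultiplier rmin ε σ μ} (S.kktMultiplier rmin ε σ)) ∧
      -- the right-derivative exists, is right-continuous, and has the stated signs
      (∀ σ ∈ Set.Ico 0 σmax,
        HasDerivWithinAt (S.f rmin ε) (OptAlloc.rightDeriv (S.f rmin ε) σ) (Set.Ioi σ) σ ∧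
        ContinuousWithinAt (OptAlloc.rightDeriv (S.f rmin ε)) (Set.Ioi σ) σ ∧
        (∀ i ∈ S.J rmin ε σ, 0 < OptAlloc.rightDeriv (S.f rmin ε) σ i) ∧
        (∀ i ∉ S.J rmin ε σ, OptAlloc.rightDeriv (S.f rmin ε) σ i = 0)) := by
  open OptAlloc OptAlloc.Network in
  have hposCh : ∀ γ ∈ Ch N σmax, ∀ i, 0 < γ i + rmin := fun γ hγ i => by
    have := (mem_Ch.1 hγ).1 i
    linarith
  -- Tube argument: compactness of `Ch` turns neighbourhoods of the points `(0, γ)` into one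
  -- neighbourhood of `ε = 0`.
  have hev := (isCompact_Ch (N := N) σmax).eventually_forall_of_forall_eventually (x₀ := (0 : ℝ))
    (P := fun ε γ => (∃ X, S.IsCov rmin ε γ X) ∧
      ContDiffAt ℝ 2 (S.η rmin ε) γ ∧ DiagDominant (hessian (S.η rmin ε) γ))
    fun γ hγ => eventually_regular hS hn (hposCh γ hγ)
  obtain ⟨δ, hδ, hball⟩ := Metric.eventually_nhds_iff.1 hev
  -- Halving puts the closed range `|ε| ≤ ε₀` inside the open ball of radius `δ`.
  refine ⟨δ / 2, by positivity, fun ε hε => ?_⟩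
  have hreg := hball (y := ε) (by rw [Real.dist_eq, sub_zero]; linarith)
  have hη : ∀ x ∈ Ch N σmax, ContDiffAt ℝ 2 (S.η rmin ε) x := fun x hx => (hreg x hx).2.1
  have hH : ∀ x ∈ Ch N σmax, DiagDominant (hessian (S.η rmin ε) x) := fun x hx => (hreg x hx).2.2
  have hdiff : ∀ x ∈ Ch N σmax, DifferentiableAt ℝ (S.η rmin ε) x := fun x hx =>
    (hη x hx).differentiableAt two_ne_zero
  have hf : ∀ σ ∈ Set.Icc 0 σmax,
      S.f rmin ε σ ∈ Sp N σ ∧ IsMinOn (S.η rmin ε) (Sp N σ) (S.f rmin ε σ) := by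
    intro σ hσ
    have hex : ∃ γ, γ ∈ Sp N σ ∧ IsMinOn (S.η rmin ε) (Sp N σ) γ :=
      (isCompact_Sp σ).exists_isMinOn (nonempty_Sp hN hσ.1) fun x hx =>
        (hdiff x (Sp_subset_Ch hσ.2 hx)).continuousAt.continuousWithinAt
    exact Classical.epsilon_spec hex
  have hfC : ∀ σ ∈ Set.Icc 0 σmax, S.f rmin ε σ ∈ Ch N σmax := fun σ hσ =>
    Sp_subset_Ch hσ.2 (hf σ hσ).1
  have hdη : ∀ σ ∈ Set.Icc 0 σmax, ∀ i,
      S.dη rmin ε (S.f rmin ε σ) i = partialDeriv (S.η rmin ε) i (S.f rmin ε σ) :=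
    fun σ hσ i => (hdiff _ (hfC σ hσ)).lineDeriv_eq_fderiv
  have hkkt : ∀ σ ∈ Set.Icc 0 σmax,
      KKT (S.η rmin ε) (S.f rmin ε σ) (S.kktMultiplier rmin ε σ) ∧
      (∃ k, partialDeriv (S.η rmin ε) k (S.f rmin ε σ) = S.kktMultiplier rmin ε σ) ∧
      IsGreatest {μ | S.IsKKTMultiplier rmin ε σ μ} (S.kktMultiplier rmin ε σ) := by
    intro σ hσ
    obtain ⟨k, hk⟩ := exists_KKT_of_isMinOn hN (hf σ hσ).1 (hf σ hσ).2 (hdiff _ (hfC σ hσ))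
    -- Any multiplier is at most the partial derivative at `k`, by equality if `k` is in the support
    -- and by the inequality otherwise; `σ = 0` needs no separate case.
    have hgr : IsGreatest {μ | S.IsKKTMultiplier rmin ε σ μ}
        (partialDeriv (S.η rmin ε) k (S.f rmin ε σ)) := by
      refine ⟨⟨fun i hi => ?_, fun j _ => ?_⟩, fun μ hμ => ?_⟩
      · rw [hdη σ hσ]; exact hk.1 i hi
      · rw [hdη σ hσ]; exact hk.2 j
      · rw [← hdη σ hσ]
        by_cases hkI : k ∈ S.I rmin ε σ
        · exact (hμ.1 k hkI).ge
        · exact hμ.2 k hkI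
    have heq : S.kktMultiplier rmin ε σ = partialDeriv (S.η rmin ε) k (S.f rmin ε σ) :=
      hgr.csSup_eq
    rw [heq]
    exact ⟨hk, ⟨k, rfl⟩, hgr⟩
  refine ⟨fun γ hγ => ⟨?_, hdiff γ hγ⟩, fun σ hσ => ⟨(hf σ hσ).1, fun γ hγ hne => ?_,
    (hkkt σ hσ).2.2⟩, fun σ hσ => ?_⟩
  · obtain ⟨X, hX⟩ := (hreg γ hγ).1
    exact ⟨X, hX, fun Y hY => isCov_unique hS (fun i => (hposCh γ hγ i).le) hY hX⟩
  · exact lt_of_fderiv_nonneg (convex_Ch σmax) hη hH (hfC σ hσ) (Sp_subset_Ch hσ.2 hγ) hne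
      ((hkkt σ hσ).1.sum_nonneg (hf σ hσ).1 hγ)
  · have hσ' : σ ∈ Set.Icc 0 σmax := ⟨hσ.1, hσ.2.le⟩
    obtain ⟨h1, h2, h3, h4⟩ := rightDeriv_of_isMinOn hη hH hf hσ (hkkt σ hσ').1 (hkkt σ hσ').2.1
    refine ⟨h1, h2, fun i hi => h3 i ?_, fun i hi => h4 i fun h => hi ?_⟩
    · rw [← hdη σ hσ']; exact hi
    · rw [J, Set.mem_ofPred_eq, hdη σ hσ']; exact h
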